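/- Let $c_0=1$ and let $c_1,c_2,\ldots$ be integers, let $F(s)=\sum_{i\ge 0} c_i\frac{s^{i+1}}{i+1}$ be the associated formal group logarithm, and let the formal group exponential be its compositional inverse, a formal power series over $\mathbb{Q}$. Let $G$ be a real-valued function on $(0,\infty)$ without zeros whose expansion at $0^+$, to all orders, is this formal group exponential (for instance, a function given near $0$ by the sum of this series, if it converges), and suppose that for every $a>0$ the function $e^{-ax}/G(x)$ is $C^\infty$ on $(0,\infty)$ and rapidly decreasing at infinity, i.e. $x^k e^{-ax}/G(x)\to 0$ as $x\to\infty$ for every $k\ge 0$. For $a>0$ and $\operatorname{Re}(s)>1$ put $$\zeta^G(s,a)=\frac{1}{\Gamma(s)}\int_0^\infty \frac{e^{-ax}}{G(x)}\,x^{s-1}\,dx .$$ Assume that $c_{p-1}\equiv 1 \pmod p$ for all primes $p\ge 2$, and that either $c_1\equiv c_3 \pmod 2$, or $c_1$ is odd and $c_3$ is even. Then, for every $a>0$, this integral converges absolutely for $\operatorname{Re}(s)>1$ and $\zeta^G(\cdot,a)$ extends holomorphically to $\mathbb{C}\setminus\{1\}$. Moreover, let $\chi$ be a nontrivial (primitive,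 complex-valued) Dirichlet character of conductor $N\geq 1$, and put $$L(G,\chi,s)=\frac{1}{N^{s}}\sum_{j=1}^{N}\chi(j)\,\zeta^G\!\left(s,\frac{j}{N}\right).$$ Then for every odd integer $n\ge 3$, $$n\,N\,L(G,\chi,1-n)\in\mathbb{Z}(\chi),$$ where $\mathbb{Z}(\chi)\subset\mathbb{C}$ is the ring generated over $\mathbb{Z}$ by the values of $\chi$. -/

import Mathlib

namespace FormalGroupZeta

open Filter Topology Asymptotics

open scoped ContDiff PowerSeries

noncomputable section

/-- The formal group logarithm `F(s) = ∑_{i ≥ 0} c_i s^(i+1) / (i+1)` with coefficients `c_i ∈ ℤ`. -/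
def formalLog (c : ℕ → ℤ) : ℚ⟦X⟧ :=
  PowerSeries.mk fun k => if k = 0 then 0 else (c (k - 1) : ℚ) / (k : ℚ)

theorem isUnit_coeff_one_formalLog {c : ℕ → ℤ} (h0 : c 0 = 1) :
    IsUnit (PowerSeries.coeff 1 (formalLog c)) := by
  simp [formalLog, h0]

/-- The formal group exponential `∑_{i ≥ 0} γ_i t^(i+1) / (i+1)` attached to `(c_i)`, `c_0 = 1`:
the compositional inverse of the formal group logarithm `F`. -/
def formalExp (c : ℕ → ℤ) (h0 : c 0 = 1) : ℚ⟦X⟧ :=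
  PowerSeries.substInvOfIsUnit (formalLog c) (isUnit_coeff_one_formalLog h0)

theorem formalLog_subst_formalExp (c : ℕ → ℤ) (h0 : c 0 = 1) :
    PowerSeries.subst (formalExp c h0) (formalLog c) = PowerSeries.X :=
  PowerSeries.subst_substInvOfIsUnit_right (formalLog c) (by simp [formalLog]) _

/-- The function `G` on `(0, ∞)` realises the formal series `g` (its expansion at `0⁺`, to all
orders, is `g`), it has no zero there, and for every `a > 0` the function `e^{-ax} / G(x)` is
`C^∞` on `(0, ∞)` and rapidly decreasing at infinity. No convergence of the series `g` is asked
for; if `g` converges to `G` near `0`, then `expansion` holds. -/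
structure IsHurwitzKernel (g : ℚ⟦X⟧) (G : ℝ → ℝ) : Prop where
  expansion : ∀ m : ℕ,
    (fun x : ℝ => G x - ∑ k ∈ Finset.range m, ((PowerSeries.coeff k g : ℚ) : ℝ) * x ^ k)
      =O[𝓝[>] 0] (fun x : ℝ => x ^ m)
  ne_zero : ∀ x : ℝ, 0 < x → G x ≠ 0
  smooth : ∀ a : ℝ, 0 < a →
    ContDiffOn ℝ ∞ (fun x : ℝ => Real.exp (-a * x) / G x) (Set.Ioi 0)
  rapidDecay : ∀ a : ℝ, 0 < a → ∀ k : ℕ,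
    Tendsto (fun x : ℝ => x ^ k * (Real.exp (-a * x) / G x)) atTop (𝓝 0)

/-- `Z` is the analytic continuation to `ℂ \ {1}` of
`s ↦ Γ(s)⁻¹ ∫_0^∞ e^{-ax} / G(x) x^{s-1} dx`, the integral being absolutely convergent
for `Re s > 1`. There is at most one such `Z` on `ℂ \ {1}`. -/
def IsHurwitzContinuation (G : ℝ → ℝ) (a : ℝ) (Z : ℂ → ℂ) : Prop :=
  DifferentiableOn ℂ Z {1}ᶜ ∧
    ∀ s : ℂ, 1 < s.re →
      MellinConvergent (fun x : ℝ => ((Real.exp (-a * x) / G x : ℝ) : ℂ)) s ∧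
      Z s = 1 / Complex.Gamma s * mellin (fun x : ℝ => ((Real.exp (-a * x) / G x : ℝ) : ℂ)) s

open Classical in
/-- The generalized Hurwitz zeta function `ζ^G(s, a)`, analytically continued to `s ≠ 1`
(with the value `0` if there were no continuation). -/
def hurwitzZeta (G : ℝ → ℝ) (s : ℂ) (a : ℝ) : ℂ :=
  if h : ∃ Z : ℂ → ℂ, IsHurwitzContinuation G a Z then h.choose s else 0

/-- `L(G, χ, s) = N^{-s} ∑_{j=1}^N χ(j) ζ^G(s, j/N)`. -/
def LFunction (G : ℝ → ℝ) {N : ℕ} (χ : DirichletCharacter ℂ N) (s : ℂ) : ℂ :=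
  1 / (N : ℂ) ^ s *
    ∑ j ∈ Finset.Icc 1 N, χ (j : ZMod N) * hurwitzZeta G s ((j : ℝ) / (N : ℝ))

end

end FormalGroupZeta

/-!
Write `F` for the formal group logarithm, `g = F⁻¹` for the exponential and `V = t / g(t)`.

Analysis. The function `x e^{-ax} / G(x)` has the asymptotic expansion `e^{-at} V(t)` at `0⁺`.
Subtracting finitely many terms of the expansion from `e^{-ax} / G(x)` continues its Mellin
transform across `Re s = 1`, and the zeros of `1 / Γ` cancel all the poles but the one at `s = 1`
(`IsMellinKernel.exists_continuation`). The value of `ζ^G(·, a)` at `1 - n` is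
`(-1)^(n-1) (n-1)!` times the coefficient of `t^n` in `e^{-at} V(t)`. Hence, for odd `n`,
`n N L(G, χ, 1 - n)` is the sum over `j` of `χ(j) · n! [t^n] e^{-jt} V(Nt)`.

Arithmetic. Since the values of `χ` add up to zero, `e^{-jt}` may be replaced by `e^{-jt} - 1`, and
it suffices that `n! [t^n] (e^{yt} - 1) V(Nt)` is an integer for all integers `N`, `y` and all odd
`n ≥ 3` (`exists_int_eq_sum_choose`). From `F(g(t)) = t` one gets `V = ∑ c_i g^i / (i + 1)`, so the
claim is that `n! [t^n] (e^{yt} - 1) g(Nt)^i` is divisible by `i + 1`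
(`succ_dvd_truncBinomialSum`). The numbers `k! [t^k] g^i` are the constant terms of `D^k X^i` for
the derivation `D = E d/dX`, `E = 1 / F'`, of `ℤ⟦X⟧`. They are divisible by `i!`, which is enough
unless `i + 1` is a prime or `4`. For `i + 1 = p` prime, `D^p` is a derivation of `𝔽_p⟦X⟧` commuting
with `D`; with `c_(p-1) ≡ 1` this gives `D^(p-1) X^(p-1) ≡ X^(p-1) - 1` modulo `X^p`, so that
`k! [t^k] g^(p-1)` is the power sum `∑ a^k` over `𝔽_p` (`constantCoeff_iterate_X_pow_eq_sum`), and
the binomial sum becomes `∑ ((N a + y)^n - (N a)^n) = 0`. For `i + 1 = 4` the constant terms of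
`D^k X^3` are computed modulo `12` (`expPowCoeff_three_modEq`); here `c_1` is odd, by the congruence
at `p = 2`.
-/

/-! ### Iterates of the derivation `E d/dX` in characteristic `p` -/

namespace FormalGroupZeta

open PowerSeries Finset

section Derivation

variable {R A : Type*} [CommRing R] [CommRing A] [Algebra R A]

/-- The higher Leibniz rule for a derivation. -/
theorem derivation_iterate_mul (D : Derivation R A A) (n : ℕ) (a b : A) :
    D^[n] (a * b) =
      ∑ ij ∈ antidiagonal n, n.choose ij.1 • (D^[ij.1] a * D^[ij.2] b) := by
  induction n with
  | zero => simp
  | succ n ih =>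
    rw [sum_antidiagonal_choose_succ_nsmul (M := A) (fun i j => D^[i] a * D^[j] b) n,
      Function.iterate_succ_apply', ih, map_sum, ← sum_add_distrib]
    refine sum_congr rfl fun ij hij => ?_
    rw [HasAntidiagonal.mem_antidiagonal] at hij
    have hc : n.choose ij.2 = n.choose ij.1 := Nat.choose_symm_of_eq_add (by omega)
    simp only [hc, map_nsmul, Derivation.leibniz, smul_eq_mul, Function.iterate_succ_apply',
      smul_add]
    rw [mul_comm (D^[ij.2] b)]

/-- In characteristic `p` the `p`-th iterate of a derivation is a derivation. -/
def frobeniusIterate (p : ℕ) [Fact p.Prime] [CharP A p] (D : Derivation R A A) :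
    Derivation R A A :=
  Derivation.mk' ((D : A →ₗ[R] A) ^ p) fun a b => by
    have hp : p.Prime := Fact.out
    obtain ⟨m, rfl⟩ : ∃ m, p = m + 1 := ⟨p - 1, by have := hp.pos; omega⟩
    have hco : ∀ x : A, ((D : A →ₗ[R] A) ^ (m + 1)) x = D^[m + 1] x := fun x => by
      rw [Module.End.pow_apply]; rfl
    rw [hco, hco, hco, derivation_iterate_mul, Nat.sum_antidiagonal_eq_sum_range_succ
      (fun i j => (m + 1).choose i • (D^[i] a * D^[j] b)), sum_range_succ, sum_range_succ']
    have : ∑ i ∈ range m, (m + 1).choose (i + 1) • (D^[i + 1] a * D^[m + 1 - (i + 1)] b) = 0 := by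
      refine sum_eq_zero fun i hi => ?_
      rw [mem_range] at hi
      obtain ⟨t, ht⟩ := hp.dvd_choose_self (k := i + 1) (by omega) (by omega)
      rw [ht, nsmul_eq_mul, Nat.cast_mul, CharP.cast_eq_zero A (m + 1)]
      ring
    rw [this]
    simp [mul_comm]

theorem frobeniusIterate_apply (p : ℕ) [Fact p.Prime] [CharP A p] (D : Derivation R A A) (x : A) :
    frobeniusIterate p D x = D^[p] x := by
  change ((D : A →ₗ[R] A) ^ p) x = _
  rw [Module.End.pow_apply]; rfl

end Derivation

section InvariantDerivation

variable {R : Type*} [CommRing R]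

/-- The derivation `E(X) d/dX` of `R⟦X⟧`. For `E = 1 / F'` it is the derivation `d/dt` written in
the coordinate `X = F⁻¹(t)`. -/
noncomputable def logDeriv (E : R⟦X⟧) : Derivation R R⟦X⟧ R⟦X⟧ := E • PowerSeries.derivative R

theorem logDeriv_apply (E f : R⟦X⟧) : logDeriv E f = E * PowerSeries.derivative R f := rfl

theorem logDeriv_X_pow (E : R⟦X⟧) (n : ℕ) : logDeriv E (X ^ n) = (n : R⟦X⟧) * X ^ (n - 1) * E := by
  rw [Derivation.leibniz_pow, logDeriv_apply, derivative_X]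
  simp [mul_assoc]

theorem logDeriv_iterate_one (E : R⟦X⟧) {k : ℕ} (hk : k ≠ 0) : (logDeriv E)^[k] 1 = 0 := by
  obtain ⟨k, rfl⟩ := Nat.exists_eq_succ_of_ne_zero hk
  rw [Nat.succ_eq_add_one, Function.iterate_succ_apply, Derivation.map_one_eq_zero]
  exact iterate_map_zero (logDeriv E) k

theorem exists_logDeriv_iterate_X_pow {E : R⟦X⟧} (hE : constantCoeff E = 1) (n j : ℕ)
    (hj : j ≤ n) : ∃ q : R⟦X⟧, (logDeriv E)^[j] (X ^ n) = X ^ (n - j) * q ∧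
      constantCoeff q = (n.descFactorial j : R) := by
  induction j with
  | zero => exact ⟨1, by simp⟩
  | succ j ih =>
    obtain ⟨q, hq, hq0⟩ := ih (by omega)
    obtain ⟨r, hr⟩ : ∃ r, n - j = r + 1 := ⟨n - j - 1, by omega⟩
    refine ⟨E * (X * PowerSeries.derivative R q + ((r + 1 : ℕ) : R⟦X⟧) * q), ?_, ?_⟩
    · rw [Function.iterate_succ_apply', hq, hr, Derivation.leibniz, logDeriv_X_pow,
        logDeriv_apply, show n - (j + 1) = r by omega]
      simp only [smul_eq_mul, Nat.add_sub_cancel]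
      ring
    · rw [Nat.descFactorial_succ, hr]
      simp [hE, hq0]

end InvariantDerivation

section ModP

variable {p : ℕ} [hp : Fact p.Prime]

instance charP_powerSeries_zmod : CharP (ZMod p)⟦X⟧ p :=
  charP_of_injective_ringHom (C_injective (R := ZMod p)) p

theorem X_pow_dvd_logDeriv {E f : (ZMod p)⟦X⟧} (h : X ^ p ∣ f) : X ^ p ∣ logDeriv E f := by
  obtain ⟨q, rfl⟩ := h
  rw [Derivation.leibniz, logDeriv_X_pow, CharP.cast_eq_zero (ZMod p)⟦X⟧ p]
  exact ⟨logDeriv E q, by simp⟩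

theorem X_pow_dvd_logDeriv_iterate {E f : (ZMod p)⟦X⟧} (h : X ^ p ∣ f) (k : ℕ) :
    X ^ p ∣ (logDeriv E)^[k] f := by
  induction k with
  | zero => exact h
  | succ k ih => rw [Function.iterate_succ_apply']; exact X_pow_dvd_logDeriv ih

theorem constantCoeff_eq_zero_of_X_pow_dvd {R : Type*} [CommRing R] {n : ℕ} (hn : n ≠ 0)
    {f : R⟦X⟧} (h : X ^ n ∣ f) : constantCoeff f = 0 := by
  obtain ⟨q, rfl⟩ := h
  simp [hn]

/-- To first order `D^p` is a constant multiple of `D`, because the two commute. -/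
theorem X_sq_dvd_iterate_X_sub {E : (ZMod p)⟦X⟧} (hE : constantCoeff E = 1) :
    X ^ 2 ∣ (logDeriv E)^[p] X - C (constantCoeff ((logDeriv E)^[p] X)) * E := by
  set D := logDeriv E with hD
  set l := D^[p] X with hl
  have hDX : D X = E := by rw [hD, logDeriv_apply, derivative_X, mul_one]
  obtain ⟨q, hq⟩ : X ^ 2 ∣ E - (1 + C (coeff 1 E) * X) := by
    rw [X_pow_dvd_iff]
    intro m hm
    interval_cases m <;> simp [hE, coeff_one]
  have hcomm : frobeniusIterate p D E = D l := by
    rw [frobeniusIterate_apply, ← hDX, hl, ← Function.iterate_succ_apply,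
      Function.iterate_succ_apply']
  have hlin : frobeniusIterate p D E = C (coeff 1 E) * l +
      X * (X * frobeniusIterate p D q + 2 * l * q) := by
    have hE' : E = 1 + (coeff 1 E) • X + X ^ 2 * q := by
      rw [smul_eq_C_mul]; linear_combination hq
    have hX : frobeniusIterate p D X = l := frobeniusIterate_apply p D X
    conv_lhs => rw [hE']
    rw [map_add, map_add, Derivation.map_one_eq_zero, Derivation.map_smul, Derivation.leibniz,
      Derivation.leibniz_pow, hX, smul_eq_C_mul]
    simp only [smul_eq_mul, nsmul_eq_mul]
    push_cast
    ring
  have hl1 : coeff 1 l = coeff 1 E * constantCoeff l := by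
    have h := congrArg constantCoeff (hcomm.symm.trans hlin)
    have h2 : constantCoeff (D l) = coeff 1 l := by
      rw [hD, logDeriv_apply, map_mul, hE, one_mul, ← coeff_zero_eq_constantCoeff_apply,
        coeff_derivative]
      simp
    rw [h2] at h
    simpa using h
  rw [X_pow_dvd_iff]
  intro m hm
  interval_cases m
  · simp [hE]
  · simp [hl1, mul_comm]

/-- The relation `D^(p-1) X^(p-1) = -1 + X^(p-1)` modulo `X^p`. The coefficient of `X^(p-1)` on the
right is in general the coefficient `u_(p-1)` of `u = 1 / E`, because `u * D f = f'` has no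
coefficient at `X^(p-1)` in characteristic `p`. -/
theorem X_pow_dvd_iterate_X_pow_sub {E u : (ZMod p)⟦X⟧} (hEu : E * u = 1)
    (hu : constantCoeff u = 1) (hup : coeff (p - 1) u = 1) :
    X ^ p ∣ (logDeriv E)^[p - 1] (X ^ (p - 1)) - (-1 + X ^ (p - 1)) := by
  have hp2 : 2 ≤ p := hp.out.two_le
  have hE : constantCoeff E = 1 := by
    have := congrArg constantCoeff hEu
    simpa [hu] using this
  set D := logDeriv E with hD
  set l := constantCoeff (D^[p] X) with hl
  obtain ⟨Q, hQ⟩ : ∃ Q, Q = D^[p - 1] (X ^ (p - 1)) := ⟨_, rfl⟩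
  rw [← hQ]
  have hQ0 : constantCoeff Q = -1 := by
    obtain ⟨q, hq, hq0⟩ := exists_logDeriv_iterate_X_pow hE (p - 1) (p - 1) le_rfl
    rw [hQ, hq, Nat.sub_self, pow_zero, one_mul, hq0, Nat.descFactorial_self,
      ZMod.wilsons_lemma]
  -- `D Q = D^p X^(p-1) = (p-1) X^(p-2) D^p X`, where `D^p X` matters only modulo `X^2`
  have hDQ : X ^ p ∣ D (Q - C l * X ^ (p - 1)) := by
    have h1 : D Q = ((p - 1 : ℕ) : (ZMod p)⟦X⟧) * X ^ (p - 2) * D^[p] X := by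
      have h2 : D Q = frobeniusIterate p D (X ^ (p - 1)) := by
        rw [frobeniusIterate_apply, hQ, ← Function.iterate_succ_apply' D]
        congr 2
        omega
      rw [h2, Derivation.leibniz_pow, frobeniusIterate_apply]
      simp [mul_assoc, Nat.sub_sub]
    have h3 : D (C l * X ^ (p - 1)) =
        ((p - 1 : ℕ) : (ZMod p)⟦X⟧) * X ^ (p - 2) * (C l * E) := by
      rw [← smul_eq_C_mul, Derivation.map_smul, hD, logDeriv_X_pow, smul_eq_C_mul]
      rw [Nat.sub_sub]
      ring
    obtain ⟨r, hr⟩ := X_sq_dvd_iterate_X_sub (p := p) hE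
    rw [map_sub, h1, h3, ← mul_sub, hr]
    refine ⟨((p - 1 : ℕ) : (ZMod p)⟦X⟧) * r, ?_⟩
    have : (X : (ZMod p)⟦X⟧) ^ p = X ^ (p - 2) * X ^ 2 := by
      rw [← pow_add]; congr 1; omega
    rw [this]; ring
  have hd : X ^ p ∣ PowerSeries.derivative (ZMod p) (Q - C l * X ^ (p - 1)) := by
    have := hDQ.mul_left u
    rwa [hD, logDeriv_apply, ← mul_assoc, mul_comm u, hEu, one_mul] at this
  have hQl : X ^ p ∣ Q - (-1 + C l * X ^ (p - 1)) := by
    rw [X_pow_dvd_iff] at hd ⊢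
    intro m hm
    rcases Nat.eq_zero_or_pos m with rfl | hm0
    · have : p - 1 ≠ 0 := by omega
      simp [hQ0, this]
    · obtain ⟨m, rfl⟩ : ∃ k, m = k + 1 := ⟨m - 1, by omega⟩
      have h := hd m (by omega)
      rw [coeff_derivative] at h
      have hne : ((m : ZMod p) + 1) ≠ 0 := by
        have : ((m + 1 : ℕ) : ZMod p) ≠ 0 := by
          rw [Ne, ZMod.natCast_eq_zero_iff]
          exact fun h => absurd (Nat.le_of_dvd (by omega) h) (by omega)
        simpa using this
      have h' := (mul_eq_zero.mp h).resolve_right hne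
      rw [← h']
      simp [coeff_one]
  -- compare the coefficients of `X^(p-1)` in `u * Q = u * D(D^(p-2) X^(p-1))`, a derivative
  have hl1 : l = 1 := by
    have h1 : coeff (p - 1) (u * Q) = 0 := by
      have : Q = D (D^[p - 2] (X ^ (p - 1))) := by
        rw [hQ, ← Function.iterate_succ_apply' D]
        congr 2
        omega
      rw [this, hD, logDeriv_apply, ← mul_assoc, mul_comm u, hEu, one_mul, coeff_derivative]
      have hc : ((p - 1 : ℕ) : ZMod p) + 1 = 0 := by
        have : ((p - 1 + 1 : ℕ) : ZMod p) = 0 := by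
          rw [Nat.sub_add_cancel hp.out.one_le]; simp
        simpa using this
      rw [hc, mul_zero]
    obtain ⟨r, hr⟩ := hQl
    have h2 : u * Q = -u + C l * (u * X ^ (p - 1)) + X ^ p * (u * r) := by
      linear_combination u * hr
    rw [h2] at h1
    have h3 : coeff (p - 1) (X ^ p * (u * r)) = 0 :=
      X_pow_dvd_iff.mp (dvd_mul_right _ _) _ (by omega)
    have h4 : coeff (p - 1) (u * X ^ (p - 1)) = 1 := by
      have := coeff_mul_X_pow u (p - 1) 0
      rw [zero_add] at this
      rw [this, coeff_zero_eq_constantCoeff_apply, hu]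
    rw [map_add, map_add, h3, coeff_C_mul, h4, map_neg, hup] at h1
    linear_combination h1
  rw [hl1] at hQl
  simpa using hQl

/-- Modulo `p` the numbers `k! [t^k] F⁻¹(t)^(p-1)` are the power sums over `𝔽_p`, as soon as
`F' = u` has `u_(p-1) = 1`. -/
theorem constantCoeff_iterate_X_pow_eq_sum {E u : (ZMod p)⟦X⟧} (hEu : E * u = 1)
    (hu : constantCoeff u = 1) (hup : coeff (p - 1) u = 1) (k : ℕ) :
    constantCoeff ((logDeriv E)^[k] (X ^ (p - 1))) = ∑ a : ZMod p, a ^ k := by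
  have hp2 : 2 ≤ p := hp.out.two_le
  have hE : constantCoeff E = 1 := by
    have := congrArg constantCoeff hEu
    simpa [hu] using this
  have hQ := X_pow_dvd_iterate_X_pow_sub hEu hu hup
  induction k using Nat.strong_induction_on with
  | _ k ih =>
    rcases lt_or_ge k (p - 1) with hk | hk
    · obtain ⟨q, hq, -⟩ := exists_logDeriv_iterate_X_pow hE (p - 1) k hk.le
      rw [FiniteField.sum_pow_lt_card_sub_one (ZMod p) k (by rwa [ZMod.card])]
      exact constantCoeff_eq_zero_of_X_pow_dvd (n := p - 1 - k) (by omega) ⟨q, hq⟩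
    · obtain ⟨j, rfl⟩ : ∃ j, k = j + (p - 1) := ⟨k - (p - 1), by omega⟩
      have h0 := constantCoeff_eq_zero_of_X_pow_dvd hp.out.ne_zero
        (X_pow_dvd_logDeriv_iterate (E := E) hQ j)
      have hsub : ∀ f g : (ZMod p)⟦X⟧, (logDeriv E)^[j] (f - g) =
          (logDeriv E)^[j] f - (logDeriv E)^[j] g := fun f g => iterate_map_sub (logDeriv E) j f g
      rw [hsub, ← Function.iterate_add_apply, map_sub, sub_eq_zero] at h0
      rw [h0, neg_add_eq_sub, hsub, map_sub]
      rcases Nat.eq_zero_or_pos j with rfl | hj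
      · have h1 : p - 1 ≠ 0 := by omega
        have hs := FiniteField.sum_pow_units (ZMod p) (p - 1)
        rw [ZMod.card, if_pos dvd_rfl] at hs
        have : ∑ a : ZMod p, a ^ (p - 1) = -1 := by
          rw [← hs, ← Finset.sum_subset (Finset.subset_univ (Finset.univ.erase (0 : ZMod p)))]
          · refine (Finset.sum_bij (fun (x : (ZMod p)ˣ) _ => (x : ZMod p)) ?_ ?_ ?_ ?_).symm
            · intro x _; simp
            · intro x _ y _ h; exact Units.ext h
            · intro y hy; exact ⟨Units.mk0 y (by simpa using hy), by simp⟩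
            · intro x _; simp
          · intro x _ hx
            have : x = 0 := by simpa using hx
            simp [this, h1]
        simp [h1, this]
      · rw [logDeriv_iterate_one E hj.ne', ih j (by omega), map_zero, sub_zero]
        refine sum_congr rfl fun a _ => ?_
        rcases eq_or_ne a 0 with rfl | ha
        · rw [zero_pow hj.ne', zero_pow (by omega)]
        · rw [pow_add, ZMod.pow_card_sub_one_eq_one ha, mul_one]

end ModP

end FormalGroupZeta

/-! ### Divisibility of the coefficients of powers of the formal exponential -/

namespace FormalGroupZeta

open PowerSeries Finset

open scoped Nat

section Integrality

/-- `m` divides every coefficient of `f` in the basis `X^j / j!`. -/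
def HurwitzDvd (m : ℤ) (f : ℤ⟦X⟧) : Prop := ∀ j : ℕ, m ∣ (j ! : ℤ) * coeff j f

theorem HurwitzDvd.logDeriv {m : ℤ} {f : ℤ⟦X⟧} (hf : HurwitzDvd m f) (E : ℤ⟦X⟧) :
    HurwitzDvd m (logDeriv E f) := by
  intro j
  rw [logDeriv_apply, coeff_mul, mul_sum]
  refine dvd_sum fun ab hab => ?_
  rw [HasAntidiagonal.mem_antidiagonal] at hab
  obtain ⟨t, ht⟩ := Nat.factorial_dvd_factorial (show ab.2 ≤ j by omega)
  rw [coeff_derivative, ht]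
  obtain ⟨r, hr⟩ := hf (ab.2 + 1)
  rw [Nat.factorial_succ] at hr
  push_cast at hr ⊢
  exact ⟨t * coeff ab.1 E * r, by linear_combination (t * coeff ab.1 E : ℤ) * hr⟩

theorem HurwitzDvd.logDeriv_iterate {m : ℤ} {f : ℤ⟦X⟧} (hf : HurwitzDvd m f) (E : ℤ⟦X⟧) (k : ℕ) :
    HurwitzDvd m ((FormalGroupZeta.logDeriv E)^[k] f) := by
  induction k with
  | zero => exact hf
  | succ k ih => rw [Function.iterate_succ_apply']; exact ih.logDeriv E

theorem HurwitzDvd.dvd_constantCoeff {m : ℤ} {f : ℤ⟦X⟧} (hf : HurwitzDvd m f) :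
    m ∣ constantCoeff f := by
  simpa using hf 0

/-- `k!` times the coefficient of `t^k` in `F⁻¹(t)^i`, where `F' = 1 / E`. -/
noncomputable def expPowCoeff (E : ℤ⟦X⟧) (i k : ℕ) : ℤ :=
  constantCoeff ((logDeriv E)^[k] (X ^ i))

theorem factorial_dvd_expPowCoeff (E : ℤ⟦X⟧) (i k : ℕ) : (i ! : ℤ) ∣ expPowCoeff E i k := by
  refine (HurwitzDvd.logDeriv_iterate (fun j => ?_) E k).dvd_constantCoeff
  rw [coeff_X_pow]
  split_ifs with h
  · simp [h]
  · simp

theorem iterate_constantCoeff_modEq {m : ℤ} {f g : ℤ⟦X⟧} (h : HurwitzDvd m (f - g)) (E : ℤ⟦X⟧)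
    (k : ℕ) : constantCoeff ((logDeriv E)^[k] f) ≡ constantCoeff ((logDeriv E)^[k] g) [ZMOD m] := by
  have h1 := (h.logDeriv_iterate E k).dvd_constantCoeff
  rw [iterate_map_sub (logDeriv E) k f g, map_sub] at h1
  exact (Int.modEq_iff_dvd.mpr h1).symm

theorem hurwitzDvd_of_le_three {f : ℤ⟦X⟧} (h0 : 12 ∣ coeff 0 f) (h1 : 12 ∣ coeff 1 f)
    (h2 : 6 ∣ coeff 2 f) (h3 : 2 ∣ coeff 3 f) : HurwitzDvd 12 f := by
  intro j
  rcases lt_or_ge j 4 with hj | hj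
  · interval_cases j
    · simpa using h0
    · simpa using h1
    · simp only [Nat.factorial]; push_cast; omega
    · simp only [Nat.factorial]; push_cast; omega
  · have : (4 ! : ℤ) ∣ (j ! : ℤ) := by exact_mod_cast Nat.factorial_dvd_factorial hj
    exact ((show (12 : ℤ) ∣ (4 ! : ℤ) by decide).trans this).mul_right _

/-- The numbers `k! [t^k] F⁻¹(t)^3` modulo `12`, when `F'' (0)` is odd: with respect to the basis
`X^j / j!` and modulo the multiples of `12`, the derivation `D` maps `X^3` to `3 X^2 + X^3`,
`3 X^2` to `6 X` and `6 X` to `6 + 6 X`. -/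
theorem expPowCoeff_three_modEq {E : ℤ⟦X⟧} (hE : constantCoeff E = 1) (hE1 : Odd (coeff 1 E))
    (k : ℕ) : expPowCoeff E 3 k ≡ if Odd k ∧ 3 ≤ k then 6 else 0 [ZMOD 12] := by
  obtain ⟨e, he⟩ := hE1
  have hadd : ∀ (k : ℕ) (f g : ℤ⟦X⟧), constantCoeff ((logDeriv E)^[k] (f + g)) =
      constantCoeff ((logDeriv E)^[k] f) + constantCoeff ((logDeriv E)^[k] g) := fun k f g => by
    rw [iterate_map_add (logDeriv E), map_add]
  have hCmul : ∀ (r : ℤ) (f : ℤ⟦X⟧), logDeriv E (C r * f) = C r * logDeriv E f := fun r f => by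
    rw [← smul_eq_C_mul, Derivation.map_smul, smul_eq_C_mul]
  have hX : logDeriv E X = E := by rw [logDeriv_apply, derivative_X, mul_one]
  have hC : ∀ k, constantCoeff ((logDeriv E)^[k] (C 6 * X)) ≡
      if 1 ≤ k then 6 else 0 [ZMOD 12] := by
    intro k
    induction k with
    | zero => simp
    | succ k ih =>
      have h : HurwitzDvd 12 (logDeriv E (C 6 * X) - (C 6 + C 6 * X)) := by
        rw [hCmul, hX]
        apply hurwitzDvd_of_le_three <;> simp only [map_sub, map_add, coeff_C_mul, coeff_X, coeff_C] <;>
          simp [hE, he] <;> omega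
      rw [Function.iterate_succ_apply]
      refine (iterate_constantCoeff_modEq h E k).trans ?_
      rw [hadd]
      cases k with
      | zero =>
        simp only [Function.iterate_zero, id, constantCoeff_C, map_mul, constantCoeff_X]
        simp
      | succ k =>
        have h6 : logDeriv E (C 6) = 0 := by rw [logDeriv_apply, derivative_C, mul_zero]
        have h0 : (logDeriv E)^[k + 1] (C 6) = 0 := by
          rw [Function.iterate_succ_apply, h6, iterate_map_zero (logDeriv E)]
        rw [h0]
        simpa using ih
  have hB : ∀ k, constantCoeff ((logDeriv E)^[k] (C 3 * X ^ 2)) ≡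
      if 2 ≤ k then 6 else 0 [ZMOD 12] := by
    intro k
    cases k with
    | zero => simp
    | succ k =>
      have h : HurwitzDvd 12 (logDeriv E (C 3 * X ^ 2) - C 6 * X) := by
        have h2 : ((2 : ℕ) : ℤ⟦X⟧) = C 2 := (map_ofNat C 2).symm
        rw [hCmul, logDeriv_X_pow, h2, mul_assoc]
        apply hurwitzDvd_of_le_three <;>
          simp only [map_sub, coeff_C_mul, coeff_X, coeff_X_pow_mul'] <;>
          simp [hE, he] <;> omega
      rw [Function.iterate_succ_apply]
      refine (iterate_constantCoeff_modEq h E k).trans ((hC k).trans ?_)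
      simp
  induction k with
  | zero => simp [expPowCoeff]
  | succ k ih =>
    have h : HurwitzDvd 12 (logDeriv E (X ^ 3) - (C 3 * X ^ 2 + X ^ 3)) := by
      have h3 : ((3 : ℕ) : ℤ⟦X⟧) = C 3 := (map_ofNat C 3).symm
      rw [logDeriv_X_pow, h3, mul_assoc]
      apply hurwitzDvd_of_le_three <;>
        simp only [map_sub, map_add, coeff_C_mul, coeff_X_pow, coeff_X_pow_mul'] <;>
        simp [hE, he] <;> omega
    have h' := iterate_constantCoeff_modEq h E k
    rw [← Function.iterate_succ_apply, hadd] at h'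
    refine h'.trans (((hB k).add ih).trans ?_)
    rcases Nat.even_or_odd k with hk | hk
    · have h1 : ¬ Odd k := Nat.not_odd_iff_even.mpr hk
      have h2 : Odd (k + 1) := hk.add_one
      simp [h1, h2]
    · have h1 : ¬ Odd (k + 1) := Nat.not_odd_iff_even.mpr hk.add_one
      rcases lt_or_ge k 2 with h2 | h2
      · have h3 : ¬ 3 ≤ k := by omega
        have h4 : ¬ 2 ≤ k := by omega
        simp [h1, h3, h4]
      · have h3 : 3 ≤ k := by obtain ⟨r, hr⟩ := hk; omega
        simp only [h1, h2, h3, hk, and_self, if_true, false_and, if_false]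
        decide

theorem map_logDeriv_iterate {R S : Type*} [CommRing R] [CommRing S] (h : R →+* S) (E f : R⟦X⟧)
    (k : ℕ) : PowerSeries.map h ((logDeriv E)^[k] f) =
      (logDeriv (PowerSeries.map h E))^[k] (PowerSeries.map h f) := by
  induction k with
  | zero => rfl
  | succ k ih =>
    rw [Function.iterate_succ_apply', Function.iterate_succ_apply', ← ih, logDeriv_apply,
      logDeriv_apply, map_mul]
    congr 1
    ext n
    simp [coeff_derivative]

theorem map_expPowCoeff {R : Type*} [CommRing R] (E : ℤ⟦X⟧) (i k : ℕ) :
    (expPowCoeff E i k : R) =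
      constantCoeff ((logDeriv (PowerSeries.map (Int.castRingHom R) E))^[k] (X ^ i)) := by
  have h := map_logDeriv_iterate (Int.castRingHom R) E (X ^ i) k
  rw [map_pow, map_X] at h
  rw [← h, ← coeff_zero_eq_constantCoeff_apply, coeff_map, coeff_zero_eq_constantCoeff_apply]
  rfl

/-- `n!` times the coefficient of `t^n` in `(e^{yt} - 1) H(Nt)`, where `H = (F⁻¹)^i`. -/
noncomputable def truncBinomialSum (E : ℤ⟦X⟧) (N y : ℤ) (i n : ℕ) : ℤ :=
  ∑ k ∈ range n, (n.choose k : ℤ) * N ^ k * expPowCoeff E i k * y ^ (n - k)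

theorem zmod_sum_pow_of_odd {p : ℕ} [hp : Fact p.Prime] (hp2 : p ≠ 2) {n : ℕ} (hn : Odd n) :
    ∑ a : ZMod p, a ^ n = 0 := by
  have h : ∑ a : ZMod p, a ^ n = -∑ a : ZMod p, a ^ n := by
    conv_lhs => rw [← Equiv.sum_comp (Equiv.neg (ZMod p))]
    simp [hn.neg_pow]
  have h2 : (2 : ZMod p) ≠ 0 := Ring.two_ne_zero (by rwa [ringChar.eq (ZMod p) p] )
  have h3 : (2 : ZMod p) * ∑ a : ZMod p, a ^ n = 0 := by linear_combination h
  exact (mul_eq_zero.mp h3).resolve_left h2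

/-- The sum is `∑ₐ ((N a + y)^n - (N a)^n)` over `𝔽_p`. For `N ≠ 0` the substitution `b = N a + y`
turns it into `(1 - N^n) ∑ₐ a^n`, where the second factor vanishes if `p` and `n` are odd. -/
theorem zmod_sum_truncBinomial {p : ℕ} [hp : Fact p.Prime] (N y : ZMod p) {n : ℕ} (hn : Odd n) :
    ∑ k ∈ range n, (n.choose k : ZMod p) * N ^ k * (∑ a : ZMod p, a ^ k) * y ^ (n - k) = 0 := by
  have h1 : ∑ k ∈ range n, (n.choose k : ZMod p) * N ^ k * (∑ a : ZMod p, a ^ k) * y ^ (n - k) =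
      ∑ a : ZMod p, (N * a + y) ^ n - N ^ n * ∑ a : ZMod p, a ^ n := by
    simp_rw [add_pow, sum_range_succ _ n]
    rw [sum_add_distrib, sum_comm, mul_sum]
    have : ∑ x : ZMod p, (N * x) ^ n * y ^ (n - n) * (n.choose n : ZMod p) =
        ∑ a : ZMod p, N ^ n * a ^ n := by simp [mul_pow]
    rw [this, add_sub_cancel_right]
    refine sum_congr rfl fun k _ => ?_
    rw [mul_sum, sum_mul]
    refine sum_congr rfl fun a _ => ?_
    rw [mul_pow]; ring
  rw [h1]
  rcases eq_or_ne N 0 with rfl | hN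
  · have : n ≠ 0 := by rintro rfl; simp at hn
    simp [this]
  · have h2 : ∑ a : ZMod p, (N * a + y) ^ n = ∑ b : ZMod p, b ^ n :=
      Equiv.sum_comp ((Equiv.mulLeft₀ N hN).trans (Equiv.addRight y)) (fun b => b ^ n)
    rw [h2]
    by_cases hp2 : p = 2
    · subst hp2
      have : N = 1 := by simpa using ZMod.pow_card_sub_one_eq_one hN
      simp [this]
    · simp [zmod_sum_pow_of_odd hp2 hn]

theorem dvd_factorial_pred {n : ℕ} (h2 : 2 ≤ n) (hn : ¬ n.Prime) (h4 : n ≠ 4) :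
    n ∣ (n - 1)! := by
  obtain ⟨a, b, hab, ha, hb⟩ : ∃ a b, a * b = n ∧ 2 ≤ a ∧ a ≤ b := by
    obtain ⟨b, hb⟩ := n.minFac_dvd
    have hp : n.minFac.Prime := Nat.minFac_prime (by omega)
    refine ⟨n.minFac, b, hb.symm, hp.two_le, ?_⟩
    have := Nat.minFac_le_div (by omega) hn
    have h : n / n.minFac = b := Nat.div_eq_of_eq_mul_right hp.pos hb
    omega
  have key : ∀ m, a < m → m ≤ n - 1 → b ∣ m → n ∣ (n - 1)! := by
    intro m h1 h2 h3
    have h5 : a ∣ (m - 1)! := Nat.dvd_factorial (by omega) (by omega)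
    have h6 : a * b ∣ m ! := by
      rw [← Nat.mul_factorial_pred (by omega : m ≠ 0), mul_comm]
      exact mul_dvd_mul h3 h5
    rw [hab] at h6
    exact h6.trans (Nat.factorial_dvd_factorial h2)
  have h2b : 2 * b ≤ n := by rw [← hab]; exact Nat.mul_le_mul_right b ha
  rcases lt_or_eq_of_le hb with h | h
  · exact key b h (by omega) dvd_rfl
  · -- for a square `a²` with `a ≥ 3` use the two factors `a` and `2a` of `(a² - 1)!`
    have h3 : 3 ≤ a := by
      by_contra hlt
      have : a = 2 := by omega
      subst this; omega
    have h3b : 3 * b ≤ n := by rw [← hab]; exact Nat.mul_le_mul_right b h3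
    exact key (2 * b) (by omega) (by omega) (dvd_mul_left _ _)

theorem two_dvd_sum_choose_odd {n : ℕ} (hn : Odd n) (h3 : 3 ≤ n) :
    (2 : ℤ) ∣ ∑ k ∈ range n, (n.choose k : ℤ) * (if Odd k ∧ 3 ≤ k then 1 else 0) := by
  have h1 : 2 * ∑ k ∈ range (n + 1), (n.choose k : ℤ) * (if Odd k then 1 else 0) = 2 ^ n := by
    have ha := Int.alternating_sum_range_choose_of_ne (n := n) (by omega)
    have hb : ∑ k ∈ range (n + 1), (n.choose k : ℤ) = 2 ^ n := by
      exact_mod_cast Nat.sum_range_choose n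
    have hc : 2 * ∑ k ∈ range (n + 1), (n.choose k : ℤ) * (if Odd k then 1 else 0) =
        ∑ k ∈ range (n + 1), (n.choose k : ℤ) -
          ∑ k ∈ range (n + 1), (-1) ^ k * (n.choose k : ℤ) := by
      rw [mul_sum, ← sum_sub_distrib]
      refine sum_congr rfl fun k _ => ?_
      rcases Nat.even_or_odd k with hk | hk
      · simp [hk.neg_one_pow, Nat.not_odd_iff_even.mpr hk]
      · simp only [hk.neg_one_pow, hk, if_true]; ring
    rw [hc, ha, hb, sub_zero]
  have h2 : ∑ k ∈ range n, (n.choose k : ℤ) * (if Odd k ∧ 3 ≤ k then 1 else 0) =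
      ∑ k ∈ range n, (n.choose k : ℤ) * (if Odd k then 1 else 0) - n := by
    have : (n : ℤ) = ∑ k ∈ range n, if k = 1 then (n : ℤ) else 0 := by
      rw [sum_ite_eq' (range n) 1, if_pos (by rw [mem_range]; omega)]
    conv_rhs => rw [this]
    rw [← sum_sub_distrib]
    refine sum_congr rfl fun k _ => ?_
    rcases eq_or_ne k 1 with rfl | hk1
    · simp
    · by_cases hk : Odd k
      · have : 3 ≤ k := by obtain ⟨r, hr⟩ := hk; omega
        simp [hk, this, hk1]
      · simp [hk, hk1]
  rw [sum_range_succ, if_pos hn, Nat.choose_self] at h1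
  rw [h2]
  obtain ⟨r, rfl⟩ := hn
  have h4 : (2 : ℤ) ^ (2 * r + 1) = 4 * 2 ^ (2 * r - 1) := by
    rw [show 2 * r + 1 = 2 + (2 * r - 1) by omega, pow_add]; norm_num
  rw [h4] at h1
  push_cast at h1 ⊢
  omega

theorem four_dvd_truncBinomialSum_three {E : ℤ⟦X⟧} (hE : constantCoeff E = 1)
    (hE1 : Odd (coeff 1 E)) (N y : ℤ) {n : ℕ} (hn : Odd n) (h3 : 3 ≤ n) :
    4 ∣ truncBinomialSum E N y 3 n := by
  have h1 : truncBinomialSum E N y 3 n ≡ 6 * ∑ k ∈ range n, (n.choose k : ℤ) * N ^ k *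
      (if Odd k ∧ 3 ≤ k then 1 else 0) * y ^ (n - k) [ZMOD 12] := by
    rw [mul_sum]
    refine Int.ModEq.sum fun k _ => ?_
    have := ((expPowCoeff_three_modEq hE hE1 k).mul_left ((n.choose k : ℤ) * N ^ k)).mul_right
      (y ^ (n - k))
    split_ifs at this ⊢ with hk
    · rw [show 6 * ((n.choose k : ℤ) * N ^ k * 1 * y ^ (n - k)) =
        (n.choose k : ℤ) * N ^ k * 6 * y ^ (n - k) by ring]
      exact this
    · simpa using this
  have h2 : (2 : ℤ) ∣ ∑ k ∈ range n, (n.choose k : ℤ) * N ^ k *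
      (if Odd k ∧ 3 ≤ k then 1 else 0) * y ^ (n - k) := by
    by_cases hNy : Odd N ∧ Odd y
    · have h := two_dvd_sum_choose_odd hn h3
      refine (Int.ModEq.dvd_iff (Int.ModEq.sum fun k _ => ?_)).mpr h
      have hN1 : N ^ k ≡ 1 [ZMOD 2] := Int.odd_iff.mp hNy.1.pow
      have hy1 : y ^ (n - k) ≡ 1 [ZMOD 2] := Int.odd_iff.mp hNy.2.pow
      have := ((hN1.mul_left (n.choose k : ℤ)).mul_right
        (if Odd k ∧ 3 ≤ k then 1 else 0)).mul hy1
      simpa using this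
    · refine dvd_sum fun k hk => ?_
      rw [mem_range] at hk
      split_ifs with h
      · rcases not_and_or.mp hNy with h' | h'
        · have : (2 : ℤ) ∣ N ^ k :=
            (even_iff_two_dvd.mp (Int.not_odd_iff_even.mp h')).trans (dvd_pow_self _ (by omega))
          exact (this.mul_left _).mul_right _ |>.mul_right _
        · have : (2 : ℤ) ∣ y ^ (n - k) :=
            (even_iff_two_dvd.mp (Int.not_odd_iff_even.mp h')).trans (dvd_pow_self _ (by omega))
          exact this.mul_left _
      · simp
  obtain ⟨t, ht⟩ := h2
  rw [ht] at h1
  have := Int.modEq_iff_dvd.mp h1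
  omega

/-- The sum `n! [t^n] (e^{yt} - 1) F⁻¹(Nt)^i` is divisible by `i + 1`. If `i + 1` is neither prime
nor `4` this holds since `i + 1 ∣ i!`; for a prime it is a power sum congruence over `𝔽_p`. -/
theorem succ_dvd_truncBinomialSum {E u : ℤ⟦X⟧} (hEu : E * u = 1) (hu : constantCoeff u = 1)
    (hup : ∀ p : ℕ, p.Prime → coeff (p - 1) u ≡ 1 [ZMOD p]) (N y : ℤ) {n : ℕ} (hn : Odd n)
    (h3 : 3 ≤ n) (i : ℕ) : ((i + 1 : ℕ) : ℤ) ∣ truncBinomialSum E N y i n := by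
  have hE : constantCoeff E = 1 := by
    have := congrArg constantCoeff hEu
    simpa [hu] using this
  by_cases hprime : (i + 1).Prime
  · have : Fact (i + 1).Prime := ⟨hprime⟩
    rw [← ZMod.intCast_zmod_eq_zero_iff_dvd]
    have key : ∀ k, (expPowCoeff E i k : ZMod (i + 1)) = ∑ a : ZMod (i + 1), a ^ k := by
      intro k
      rw [map_expPowCoeff]
      refine constantCoeff_iterate_X_pow_eq_sum
        (u := PowerSeries.map (Int.castRingHom (ZMod (i + 1))) u) ?_ ?_ ?_ k
      · rw [← map_mul, hEu, map_one]
      · rw [← coeff_zero_eq_constantCoeff_apply, coeff_map, coeff_zero_eq_constantCoeff_apply, hu]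
        simp
      · rw [coeff_map]
        have := (ZMod.intCast_eq_intCast_iff _ _ _).mpr (hup (i + 1) hprime)
        simpa using this
    rw [truncBinomialSum]
    push_cast
    simp_rw [key]
    exact zmod_sum_truncBinomial _ _ hn
  · by_cases h4 : i + 1 = 4
    · obtain rfl : i = 3 := by omega
      have hE1 : Odd (coeff 1 E) := by
        have h := congrArg (coeff 1) hEu
        rw [coeff_mul] at h
        simp [Nat.antidiagonal_succ, hE, hu, coeff_one] at h
        have h2 := hup 2 Nat.prime_two
        have h2' : coeff 1 u % 2 = 1 := h2
        rw [Int.odd_iff]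
        omega
      exact four_dvd_truncBinomialSum_three hE hE1 N y hn h3
    · rcases Nat.eq_zero_or_pos i with rfl | hi
      · simp
      · have h5 : ((i + 1 : ℕ) : ℤ) ∣ (i ! : ℤ) := by
          have := dvd_factorial_pred (n := i + 1) (by omega) hprime h4
          exact_mod_cast this
        refine dvd_sum fun k _ => ?_
        exact ((h5.trans (factorial_dvd_expPowCoeff E i k)).mul_left _).mul_right _

end Integrality

end FormalGroupZeta

/-! ### The reciprocal of the formal exponential -/

namespace FormalGroupZeta

open PowerSeries Finset

open scoped Nat

section Reciprocal

theorem expPowCoeff_eq_zero (E : ℤ⟦X⟧) (hE : constantCoeff E = 1) {i k : ℕ} (h : k < i) :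
    expPowCoeff E i k = 0 := by
  obtain ⟨q, hq, -⟩ := exists_logDeriv_iterate_X_pow hE i k h.le
  exact constantCoeff_eq_zero_of_X_pow_dvd (n := i - k) (by omega) ⟨q, hq⟩

theorem X_pow_dvd_logDeriv_iterate_add {R : Type*} [CommRing R] {E f : R⟦X⟧} {m : ℕ} (k : ℕ)
    (h : X ^ (m + k) ∣ f) : X ^ m ∣ (logDeriv E)^[k] f := by
  induction k generalizing f with
  | zero => exact h
  | succ k ih =>
    rw [Function.iterate_succ_apply]
    refine ih ?_
    obtain ⟨q, rfl⟩ := h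
    rw [Derivation.leibniz, logDeriv_X_pow]
    refine dvd_add ⟨X * logDeriv E q, ?_⟩ ⟨q * ((m + (k + 1) : ℕ) : R⟦X⟧) * E, ?_⟩
    · rw [smul_eq_mul, ← add_assoc, pow_succ]; ring
    · rw [smul_eq_mul, show m + (k + 1) - 1 = m + k by omega]; ring

/-- In the coordinate `X = g(t)`, where `g' = E(g)`, the derivation `E d/dX` is `d/dt`. -/
theorem derivative_iterate_subst {E g : ℚ⟦X⟧} (hg : HasSubst g)
    (hd : PowerSeries.derivative ℚ g = E.subst g) (f : ℚ⟦X⟧) (k : ℕ) :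
    (PowerSeries.derivative ℚ)^[k] (f.subst g) = ((logDeriv E)^[k] f).subst g := by
  induction k generalizing f with
  | zero => rfl
  | succ k ih =>
    rw [Function.iterate_succ_apply, Function.iterate_succ_apply, derivative_subst hg, hd, ← ih,
      logDeriv_apply, PowerSeries.subst_mul hg, mul_comm]

theorem constantCoeff_subst_of_constantCoeff_eq_zero {g : ℚ⟦X⟧} (hg0 : constantCoeff g = 0)
    (f : ℚ⟦X⟧) : constantCoeff (f.subst g) = constantCoeff f := by
  have hg : HasSubst g := HasSubst.of_constantCoeff_zero' hg0
  obtain ⟨q, hq⟩ : X ∣ f - C (constantCoeff f) := by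
    rw [X_dvd_iff]; simp
  have h1 : f = C (constantCoeff f) + X * q := by rw [← hq]; ring
  have h2 : (C (constantCoeff f) : ℚ⟦X⟧).subst g = C (constantCoeff f) := PowerSeries.subst_C _
  conv_lhs => rw [h1]
  rw [PowerSeries.subst_add hg, PowerSeries.subst_mul hg, PowerSeries.subst_X hg, h2, map_add,
    map_mul, hg0, constantCoeff_C]
  ring

theorem factorial_mul_coeff_subst {E g : ℚ⟦X⟧} (hg0 : constantCoeff g = 0)
    (hd : PowerSeries.derivative ℚ g = E.subst g) (f : ℚ⟦X⟧) (k : ℕ) :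
    (k ! : ℚ) * coeff k (f.subst g) = constantCoeff ((logDeriv E)^[k] f) := by
  rw [← constantCoeff_iterate_derivative,
    derivative_iterate_subst (HasSubst.of_constantCoeff_zero' hg0) hd,
    constantCoeff_subst_of_constantCoeff_eq_zero hg0]

variable (c : ℕ → ℤ)

/-- The derivative `∑ c_i s^i` of the formal group logarithm. -/
noncomputable def logDensity : ℤ⟦X⟧ := PowerSeries.mk c

/-- The inverse of `∑ c_i s^i`. -/
noncomputable def logDensityInv : ℤ⟦X⟧ := invOfUnit (logDensity c) 1

variable {c}

theorem constantCoeff_logDensity (h0 : c 0 = 1) : constantCoeff (logDensity c) = 1 := by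
  rw [logDensity, ← coeff_zero_eq_constantCoeff_apply, coeff_mk, h0]

theorem logDensityInv_mul (h0 : c 0 = 1) : logDensityInv c * logDensity c = 1 := by
  rw [mul_comm]
  exact mul_invOfUnit _ _ (by rw [constantCoeff_logDensity h0]; rfl)

theorem constantCoeff_logDensityInv : constantCoeff (logDensityInv c) = 1 := by
  simp [logDensityInv]

theorem constantCoeff_formalExp (h0 : c 0 = 1) : constantCoeff (formalExp c h0) = 0 :=
  constantCoeff_substInvOfIsUnit _ _

theorem derivative_formalLog :
    PowerSeries.derivative ℚ (formalLog c) =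
      PowerSeries.map (Int.castRingHom ℚ) (logDensity c) := by
  ext k
  rw [coeff_derivative, coeff_map, formalLog, logDensity, coeff_mk, coeff_mk, if_neg (by omega)]
  have : ((k : ℚ) + 1) ≠ 0 := by positivity
  simp
  field_simp

theorem derivative_formalExp (h0 : c 0 = 1) : PowerSeries.derivative ℚ (formalExp c h0) =
    (PowerSeries.map (Int.castRingHom ℚ) (logDensityInv c)).subst (formalExp c h0) := by
  set g := formalExp c h0
  have hg : HasSubst g := HasSubst.of_constantCoeff_zero' (constantCoeff_formalExp h0)
  have h1 := congrArg (PowerSeries.derivative ℚ) (formalLog_subst_formalExp c h0)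
  rw [derivative_subst hg, derivative_X, derivative_formalLog] at h1
  have h2 : (PowerSeries.map (Int.castRingHom ℚ) (logDensityInv c)).subst g *
      (PowerSeries.map (Int.castRingHom ℚ) (logDensity c)).subst g = 1 := by
    rw [← PowerSeries.subst_mul hg, ← map_mul, logDensityInv_mul h0, map_one,
      ← coe_substAlgHom hg, map_one]
  linear_combination (-PowerSeries.derivative ℚ g) * h2 +
    (PowerSeries.map (Int.castRingHom ℚ) (logDensityInv c)).subst g * h1

/-- With `g = F⁻¹` one has `t = F(g) = g * ∑ c_i g^i / (i + 1)`, so `t / g` is the series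
`V = ∑ c_i g^i / (i + 1)`. -/
theorem exists_formalExp_factorization (h0 : c 0 = 1) : ∃ h V : ℚ⟦X⟧,
    formalExp c h0 = X * h ∧ h * V = 1 ∧ ∀ k : ℕ, (k ! : ℚ) * coeff k V =
      ∑ i ∈ range (k + 1), (c i : ℚ) / (i + 1 : ℕ) * expPowCoeff (logDensityInv c) i k := by
  set g := formalExp c h0
  have hg0 : constantCoeff g = 0 := constantCoeff_formalExp h0
  have hg : HasSubst g := HasSubst.of_constantCoeff_zero' hg0
  obtain ⟨h, hh⟩ : X ∣ g := X_dvd_iff.mpr hg0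
  let L : ℚ⟦X⟧ := PowerSeries.mk fun i => (c i : ℚ) / (i + 1 : ℕ)
  have hL : formalLog c = X * L := by
    ext k
    cases k with
    | zero => simp [formalLog]
    | succ k => rw [coeff_succ_X_mul, formalLog, coeff_mk, coeff_mk, if_neg (by omega)]; rfl
  refine ⟨h, L.subst g, hh, ?_, fun k => ?_⟩
  · have h1 : PowerSeries.subst g (formalLog c) = X := formalLog_subst_formalExp c h0
    rw [hL, PowerSeries.subst_mul hg, PowerSeries.subst_X hg] at h1
    have h2 : (X : ℚ⟦X⟧) * (h * L.subst g) = X * 1 := by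
      rw [mul_one, ← mul_assoc, ← hh]; exact h1
    exact mul_left_cancel₀ X_ne_zero h2
  · rw [factorial_mul_coeff_subst hg0 (derivative_formalExp h0)]
    set E := PowerSeries.map (Int.castRingHom ℚ) (logDensityInv c) with hE
    have h1 : X ^ (1 + k) ∣ L - ∑ i ∈ range (k + 1), ((c i : ℚ) / (i + 1 : ℕ)) • X ^ i := by
      rw [X_pow_dvd_iff]
      intro m hm
      rw [map_sub, map_sum, coeff_mk, sum_eq_single m]
      · simp
      · intro i _ him
        rw [map_smul, coeff_X_pow, if_neg him.symm, smul_zero]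
      · intro hm'
        rw [mem_range] at hm'
        omega
    have h2 := constantCoeff_eq_zero_of_X_pow_dvd one_ne_zero
      (X_pow_dvd_logDeriv_iterate_add (E := E) k h1)
    have h3 : ∀ f : ℚ⟦X⟧, (logDeriv E)^[k] f = ((logDeriv E : ℚ⟦X⟧ →ₗ[ℚ] ℚ⟦X⟧) ^ k) f :=
      fun f => by rw [Module.End.pow_apply]; rfl
    rw [h3, map_sub, map_sub, sub_eq_zero, ← h3] at h2
    rw [h2, map_sum, map_sum]
    refine sum_congr rfl fun i _ => ?_
    rw [map_smul, ← h3, map_expPowCoeff, ← hE, smul_eq_C_mul, map_mul, constantCoeff_C]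

/-- An analogue for formal groups of the Almkvist–Meurman theorem: the numbers
`n! [t^n] (e^{yt} - 1) V(Nt)`, with `V = t / F⁻¹(t)`, are integers for odd `n ≥ 3`. -/
theorem exists_int_eq_sum_choose (h0 : c 0 = 1)
    (hc : ∀ p : ℕ, p.Prime → c (p - 1) ≡ 1 [ZMOD (p : ℤ)]) {V : ℚ⟦X⟧}
    (hV : ∀ k : ℕ, (k ! : ℚ) * coeff k V =
      ∑ i ∈ range (k + 1), (c i : ℚ) / (i + 1 : ℕ) * expPowCoeff (logDensityInv c) i k)
    (N y : ℤ) {n : ℕ} (hn : Odd n) (h3 : 3 ≤ n) :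
    ∃ w : ℤ, ∑ k ∈ range n, (n.choose k : ℚ) * N ^ k * ((k ! : ℚ) * coeff k V) * y ^ (n - k) =
      w := by
  have hdiv := succ_dvd_truncBinomialSum (logDensityInv_mul h0) (constantCoeff_logDensity h0)
    (fun p hp => by rw [logDensity, coeff_mk]; exact hc p hp) N y hn h3
  choose t ht using hdiv
  refine ⟨∑ i ∈ range n, c i * t i, ?_⟩
  have h1 : ∀ k ∈ range n, (k ! : ℚ) * coeff k V =
      ∑ i ∈ range n, (c i : ℚ) / (i + 1 : ℕ) * expPowCoeff (logDensityInv c) i k := by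
    intro k hk
    rw [mem_range] at hk
    rw [hV]
    refine sum_subset (range_subset_range.mpr hk) fun i _ hi => ?_
    rw [mem_range] at hi
    rw [expPowCoeff_eq_zero _ constantCoeff_logDensityInv (by omega)]
    simp
  have h2 : ∀ i, (c i : ℚ) * t i =
      (c i : ℚ) / (i + 1 : ℕ) * truncBinomialSum (logDensityInv c) N y i n := by
    intro i
    rw [ht i]
    have : ((i : ℚ) + 1) ≠ 0 := by positivity
    push_cast
    field_simp
  push_cast
  simp_rw [h2, truncBinomialSum]
  push_cast
  simp_rw [mul_sum]
  rw [sum_comm]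
  refine sum_congr rfl fun k hk => ?_
  rw [h1 k hk, mul_sum, sum_mul]
  refine sum_congr rfl fun i _ => ?_
  push_cast
  ring

end Reciprocal

end FormalGroupZeta

/-! ### Asymptotic expansions at `0⁺` -/

namespace FormalGroupZeta

open Filter Topology Asymptotics Set

section AsymptoticExpansion

/-- The formal series `φ` is the asymptotic expansion of `f` at `0⁺`, to all orders. -/
def HasAsymptoticExpansion (f : ℝ → ℝ) (φ : PowerSeries ℝ) : Prop :=
  ∀ m : ℕ, (fun x => f x - (PowerSeries.trunc m φ).eval x) =O[𝓝[>] 0] fun x => x ^ m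

theorem eval_trunc_eq_sum (φ : PowerSeries ℝ) (m : ℕ) (x : ℝ) :
    (PowerSeries.trunc m φ).eval x = ∑ k ∈ Finset.range m, PowerSeries.coeff k φ * x ^ k := by
  rw [Polynomial.eval, PowerSeries.eval₂_trunc_eq_sum_range]
  simp

theorem polynomial_isBigO_one (P : Polynomial ℝ) :
    (fun x => P.eval x) =O[𝓝[>] 0] fun _ => (1 : ℝ) :=
  ((P.continuous.tendsto 0).mono_left nhdsWithin_le_nhds).isBigO_one ℝ

theorem polynomial_isBigO_pow {P : Polynomial ℝ} {m : ℕ} (h : ∀ k < m, P.coeff k = 0) :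
    (fun x => P.eval x) =O[𝓝[>] 0] fun x => x ^ m := by
  obtain ⟨Q, rfl⟩ := Polynomial.X_pow_dvd_iff.mpr h
  simpa using (isBigO_refl (fun x : ℝ => x ^ m) (𝓝[>] 0)).mul (polynomial_isBigO_one Q)

theorem coeff_trunc_mul_trunc_of_lt {R : Type*} [CommRing R] (f g : PowerSeries R) {m k : ℕ}
    (hk : k < m) : (PowerSeries.trunc m f * PowerSeries.trunc m g).coeff k =
      PowerSeries.coeff k (f * g) := by
  rw [PowerSeries.coeff_mul_eq_coeff_trunc_mul_trunc f g hk, ← Polynomial.coe_mul,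
    Polynomial.coeff_coe]

theorem HasAsymptoticExpansion.isBigO_one {f : ℝ → ℝ} {φ : PowerSeries ℝ}
    (hf : HasAsymptoticExpansion f φ) : f =O[𝓝[>] 0] fun _ => (1 : ℝ) := by
  simpa using hf 0

theorem HasAsymptoticExpansion.mul {f g : ℝ → ℝ} {φ ψ : PowerSeries ℝ}
    (hf : HasAsymptoticExpansion f φ) (hg : HasAsymptoticExpansion g ψ) :
    HasAsymptoticExpansion (fun x => f x * g x) (φ * ψ) := by
  intro m
  have h1 := (hf m).mul hg.isBigO_one
  have h2 := (polynomial_isBigO_one (PowerSeries.trunc m φ)).mul (hg m)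
  have h3 : (fun x => (PowerSeries.trunc m φ * PowerSeries.trunc m ψ -
      PowerSeries.trunc m (φ * ψ)).eval x) =O[𝓝[>] 0] fun x => x ^ m :=
    polynomial_isBigO_pow fun k hk => by
      rw [Polynomial.coeff_sub, coeff_trunc_mul_trunc_of_lt _ _ hk, PowerSeries.coeff_trunc,
        if_pos hk, sub_self]
  simp only [mul_one, one_mul] at h1 h2
  refine ((h1.add h2).add h3).congr_left fun x => ?_
  rw [Polynomial.eval_sub, Polynomial.eval_mul]
  ring

theorem HasAsymptoticExpansion.tendsto {f : ℝ → ℝ} {φ : PowerSeries ℝ}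
    (hf : HasAsymptoticExpansion f φ) :
    Tendsto f (𝓝[>] 0) (𝓝 (PowerSeries.constantCoeff φ)) := by
  have h1 : Tendsto (fun x : ℝ => x ^ 1) (𝓝[>] 0) (𝓝 0) := by
    have : Tendsto (fun x : ℝ => x ^ 1) (𝓝 0) (𝓝 (0 ^ 1)) := (continuous_pow 1).tendsto 0
    rw [zero_pow one_ne_zero] at this
    exact this.mono_left nhdsWithin_le_nhds
  have h2 := ((hf 1).trans_tendsto h1).add_const (PowerSeries.constantCoeff φ)
  rw [zero_add] at h2
  refine h2.congr fun x => ?_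
  rw [eval_trunc_eq_sum]
  simp

theorem HasAsymptoticExpansion.inv {f : ℝ → ℝ} {φ ψ : PowerSeries ℝ}
    (hf : HasAsymptoticExpansion f φ) (h : φ * ψ = 1) :
    HasAsymptoticExpansion (fun x => (f x)⁻¹) ψ := by
  have h0 : PowerSeries.constantCoeff φ ≠ 0 := by
    intro h0
    have := congrArg PowerSeries.constantCoeff h
    simp [h0] at this
  have hinv : (fun x => (f x)⁻¹) =O[𝓝[>] 0] fun _ => (1 : ℝ) := (hf.tendsto.inv₀ h0).isBigO_one ℝ
  intro m
  have h1 := (hf m).mul (polynomial_isBigO_one (PowerSeries.trunc m ψ))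
  have h2 : (fun x => (PowerSeries.trunc m φ * PowerSeries.trunc m ψ - 1).eval x) =O[𝓝[>] 0]
      fun x => x ^ m :=
    polynomial_isBigO_pow fun k hk => by
      rw [Polynomial.coeff_sub, coeff_trunc_mul_trunc_of_lt _ _ hk, h, PowerSeries.coeff_one,
        Polynomial.coeff_one]
      simp
  simp only [mul_one] at h1
  have h3 := (hinv.mul (h1.add h2)).neg_left
  simp only [one_mul] at h3
  refine h3.congr' ?_ EventuallyEq.rfl
  filter_upwards [hf.tendsto.eventually_ne h0] with x hx
  simp only [Polynomial.eval_sub, Polynomial.eval_mul, Polynomial.eval_one]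
  field_simp
  ring

theorem HasAsymptoticExpansion.div_id {f : ℝ → ℝ} {φ : PowerSeries ℝ}
    (hf : HasAsymptoticExpansion f (PowerSeries.X * φ)) :
    HasAsymptoticExpansion (fun x => f x / x) φ := by
  intro m
  have h1 := (hf (m + 1)).mul (isBigO_refl (fun x : ℝ => x⁻¹) (𝓝[>] 0))
  refine h1.congr' ?_ ?_
  · filter_upwards [self_mem_nhdsWithin] with x hx
    have hx0 : x ≠ 0 := (Set.mem_Ioi.mp hx).ne'
    rw [eval_trunc_eq_sum, eval_trunc_eq_sum, Finset.sum_range_succ', sub_mul, add_mul,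
      Finset.sum_mul]
    simp only [PowerSeries.coeff_succ_X_mul, PowerSeries.coeff_zero_X_mul, zero_mul, add_zero]
    congr 1
    refine Finset.sum_congr rfl fun k _ => ?_
    rw [pow_succ]
    field_simp
  · filter_upwards [self_mem_nhdsWithin] with x hx
    have hx0 : x ≠ 0 := (Set.mem_Ioi.mp hx).ne'
    rw [pow_succ]
    field_simp

theorem hasAsymptoticExpansion_exp (a : ℝ) :
    HasAsymptoticExpansion (fun x => Real.exp (a * x))
      (PowerSeries.rescale a (PowerSeries.exp ℝ)) := by
  intro m
  have h0 : Tendsto (fun x : ℝ => a * x) (𝓝[>] 0) (𝓝 0) := by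
    have : Tendsto (fun x : ℝ => a * x) (𝓝 0) (𝓝 (a * 0)) := (continuous_const_mul a).tendsto 0
    rw [mul_zero] at this
    exact this.mono_left nhdsWithin_le_nhds
  have h1 := (Real.exp_sub_sum_range_isBigO_pow m).comp_tendsto h0
  have h2 : ((fun x : ℝ => x ^ m) ∘ fun x : ℝ => a * x) =O[𝓝[>] 0] fun x => x ^ m := by
    have : ((fun x : ℝ => x ^ m) ∘ fun x : ℝ => a * x) = fun x => a ^ m * x ^ m := by
      funext x; simp [mul_pow]
    rw [this]
    exact isBigO_const_mul_self _ _ _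
  refine (h1.trans h2).congr_left fun x => ?_
  simp only [Function.comp_apply]
  rw [eval_trunc_eq_sum]
  congr 1
  refine Finset.sum_congr rfl fun k _ => ?_
  rw [PowerSeries.coeff_rescale, PowerSeries.coeff_exp, mul_pow]
  simp
  ring

end AsymptoticExpansion

end FormalGroupZeta

/-! ### Continuation of Mellin transforms -/

namespace FormalGroupZeta

open Filter Topology Asymptotics Set MeasureTheory

open scoped Nat

section MellinContinuation

variable {f : ℝ → ℝ} {b : ℕ → ℝ}

/-- The function `f(x)` minus the first `m` terms of its expansion `∑ b_k x^(k-1)` at `0`, these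
terms being cut off at `x = 1`. -/
noncomputable def mellinRemainder (f : ℝ → ℝ) (b : ℕ → ℝ) (m : ℕ) (x : ℝ) : ℂ :=
  (f x : ℂ) - ∑ k ∈ Finset.range m,
    (b k : ℂ) * indicator (Ioc 0 1) (fun t : ℝ => (t : ℂ) ^ ((k : ℂ) - 1)) x

theorem mellinRemainder_succ (m : ℕ) (x : ℝ) :
    mellinRemainder f b (m + 1) x = mellinRemainder f b m x -
      (b m : ℂ) • indicator (Ioc 0 1) (fun t : ℝ => (t : ℂ) ^ ((m : ℂ) - 1)) x := by
  rw [mellinRemainder, mellinRemainder, Finset.sum_range_succ, smul_eq_mul]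
  ring

theorem locallyIntegrableOn_mellinRemainder (hf : ContinuousOn f (Ioi 0)) (m : ℕ) :
    LocallyIntegrableOn (mellinRemainder f b m) (Ioi 0) := by
  induction m with
  | zero =>
    have : mellinRemainder f b 0 = fun x => (f x : ℂ) := by
      funext x; simp [mellinRemainder]
    rw [this]
    exact (Complex.continuous_ofReal.comp_continuousOn hf).locallyIntegrableOn measurableSet_Ioi
  | succ m ih =>
    have h1 : LocallyIntegrableOn (fun t : ℝ => (t : ℂ) ^ ((m : ℂ) - 1)) (Ioi 0) := by
      refine ContinuousOn.locallyIntegrableOn (fun t ht => ?_) measurableSet_Ioi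
      exact (Complex.continuousAt_ofReal_cpow_const t _
        (Or.inr (Set.mem_Ioi.mp ht).ne')).continuousWithinAt
    have h2 : LocallyIntegrableOn
        (indicator (Ioc 0 1) (fun t : ℝ => (t : ℂ) ^ ((m : ℂ) - 1))) (Ioi 0) := fun x hx => by
      obtain ⟨U, hU, hi⟩ := h1 x hx
      exact ⟨U, hU, hi.indicator measurableSet_Ioc⟩
    have : mellinRemainder f b (m + 1) = mellinRemainder f b m -
        (b m : ℂ) • indicator (Ioc 0 1) (fun t : ℝ => (t : ℂ) ^ ((m : ℂ) - 1)) := by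
      funext x; exact mellinRemainder_succ m x
    rw [this]
    exact ih.sub (h2.smul _)

theorem mellinRemainder_isBigO_atTop (hf : ∀ k : ℕ, Tendsto (fun x => x ^ k * f x) atTop (𝓝 0))
    (m k : ℕ) : mellinRemainder f b m =O[atTop] fun x : ℝ => x ^ (-(k : ℝ)) := by
  have h1 : (fun x => f x) =O[atTop] fun x : ℝ => x ^ (-(k : ℝ)) := by
    have h := ((hf k).isBigO_one ℝ).mul (isBigO_refl (fun x : ℝ => x ^ (-(k : ℝ))) atTop)
    refine h.congr' ?_ (Eventually.of_forall fun x => one_mul _)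
    filter_upwards [eventually_gt_atTop 0] with x hx
    rw [Real.rpow_neg hx.le, Real.rpow_natCast]
    have : x ^ k ≠ 0 := by positivity
    field_simp
  refine IsBigO.congr' (Complex.isBigO_ofReal_left.mpr h1) ?_ EventuallyEq.rfl
  filter_upwards [eventually_gt_atTop 1] with x hx
  have hx' : x ∉ Ioc (0 : ℝ) 1 := fun h => absurd h.2 (not_le.mpr hx)
  simp [mellinRemainder, indicator_of_notMem hx']

theorem mellinRemainder_isBigO_zero (hf : ∀ m : ℕ,
      (fun x => x * f x - ∑ k ∈ Finset.range m, b k * x ^ k) =O[𝓝[>] 0] fun x => x ^ m) (m : ℕ) :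
    mellinRemainder f b m =O[𝓝[>] 0] fun x : ℝ => x ^ (-(1 - m : ℝ)) := by
  have h := (hf m).mul (isBigO_refl (fun x : ℝ => x⁻¹) (𝓝[>] 0))
  refine IsBigO.congr' (Complex.isBigO_ofReal_left.mpr h) ?_ ?_
  · filter_upwards [Ioc_mem_nhdsGT (zero_lt_one' ℝ)] with x hx
    have hx0 : (x : ℂ) ≠ 0 := Complex.ofReal_ne_zero.mpr hx.1.ne'
    simp only [mellinRemainder, indicator_of_mem hx]
    push_cast
    rw [sub_mul, Finset.sum_mul]
    congr 1
    · field_simp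
    · refine Finset.sum_congr rfl fun k _ => ?_
      rw [Complex.cpow_sub _ _ hx0, Complex.cpow_natCast, Complex.cpow_one]
      field_simp
  · filter_upwards [self_mem_nhdsWithin] with x hx
    have hx0 : 0 < x := hx
    rw [neg_sub, Real.rpow_sub hx0, Real.rpow_natCast, Real.rpow_one]
    rfl

/-- The function `1 / ((s + k - 1) Γ(s))`. For `k ≥ 1` its singularity at `s = 1 - k` is removable,
and it is written here in a form valid at that point too. -/
noncomputable def polarTerm (k : ℕ) (s : ℂ) : ℂ :=
  if k = 0 then (s - 1)⁻¹ * (Complex.Gamma s)⁻¹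
  else (∏ i ∈ Finset.range (k - 1), (s + i)) * (Complex.Gamma (s + k))⁻¹

theorem inv_Gamma_eq_prod_mul (s : ℂ) (k : ℕ) :
    (Complex.Gamma s)⁻¹ = (∏ i ∈ Finset.range k, (s + i)) * (Complex.Gamma (s + k))⁻¹ := by
  induction k with
  | zero => simp
  | succ k ih =>
    rw [ih, Finset.prod_range_succ, Complex.one_div_Gamma_eq_self_mul_one_div_Gamma_add_one (s + k)]
    push_cast
    rw [add_assoc s]
    ring

theorem polarTerm_eq (k : ℕ) {s : ℂ} (hs : s + (k - 1) ≠ 0) :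
    polarTerm k s = (s + (k - 1))⁻¹ * (Complex.Gamma s)⁻¹ := by
  rw [polarTerm]
  cases k with
  | zero => simp [sub_eq_add_neg]
  | succ k =>
    rw [if_neg (by omega), inv_Gamma_eq_prod_mul s (k + 1), Finset.prod_range_succ]
    simp only [Nat.add_sub_cancel]
    push_cast at hs ⊢
    rw [add_sub_cancel_right] at hs ⊢
    field_simp

theorem differentiableAt_polarTerm (k : ℕ) {s : ℂ} (hs : s ≠ 1) :
    DifferentiableAt ℂ (polarTerm k) s := by
  have hG := Complex.differentiable_one_div_Gamma
  by_cases hk : k = 0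
  · have : polarTerm k = fun s : ℂ => (s - 1)⁻¹ * (Complex.Gamma s)⁻¹ := by
      funext s; rw [polarTerm, if_pos hk]
    rw [this]
    exact ((differentiableAt_id.sub_const (1 : ℂ)).inv (sub_ne_zero.mpr hs)).mul
      hG.differentiableAt
  · have : polarTerm k = fun s : ℂ => (∏ i ∈ Finset.range (k - 1), (s + i)) *
        (Complex.Gamma (s + k))⁻¹ := by
      funext s; rw [polarTerm, if_neg hk]
    rw [this]
    refine DifferentiableAt.mul (by fun_prop) ?_
    exact hG.differentiableAt.comp s (differentiableAt_id.add_const (k : ℂ))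

theorem polarTerm_one_sub_of_lt {k n : ℕ} (hn : 1 ≤ n) (hk : k < n) :
    polarTerm k (1 - (n : ℂ)) = 0 := by
  obtain ⟨r, rfl⟩ := Nat.exists_eq_add_of_lt hk
  have h : ∀ j : ℕ, Complex.Gamma (-(j : ℂ)) = 0 := Complex.Gamma_neg_nat_eq_zero
  rw [polarTerm]
  split_ifs with h0
  · subst h0
    have : (1 - ((0 + r + 1 : ℕ) : ℂ)) = -(r : ℂ) := by push_cast; ring
    rw [this, h]; simp
  · have : (1 - ((k + r + 1 : ℕ) : ℂ)) + k = -(r : ℂ) := by push_cast; ring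
    rw [this, h]; simp

theorem polarTerm_one_sub_self {n : ℕ} (hn : 1 ≤ n) :
    polarTerm n (1 - (n : ℂ)) = (-1) ^ (n - 1) * ((n - 1)! : ℂ) := by
  obtain ⟨r, rfl⟩ := Nat.exists_eq_add_of_le' hn
  rw [polarTerm, if_neg (by omega)]
  have h1 : (1 - ((r + 1 : ℕ) : ℂ)) + ((r + 1 : ℕ) : ℂ) = 1 := by ring
  rw [h1, Complex.Gamma_one, inv_one, mul_one, Nat.add_sub_cancel,
    ← Finset.prod_range_add_one_eq_factorial, ← Finset.prod_range_reflect]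
  push_cast
  rw [← Finset.card_range r, ← Finset.prod_const, Finset.card_range, ← Finset.prod_mul_distrib]
  refine Finset.prod_congr rfl fun i hi => ?_
  rw [Finset.mem_range] at hi
  have : ((r - 1 - i : ℕ) : ℂ) = r - 1 - i := by
    rw [Nat.cast_sub (by omega), Nat.cast_sub (by omega)]; simp
  rw [this]; ring

/-- The continuation of `Γ(s)⁻¹ ∫ f(x) x^(s-1) dx` to the half-plane `Re s > 1 - m`. -/
noncomputable def partialContinuation (f : ℝ → ℝ) (b : ℕ → ℝ) (m : ℕ) (s : ℂ) : ℂ :=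
  (Complex.Gamma s)⁻¹ * mellin (mellinRemainder f b m) s +
    ∑ k ∈ Finset.range m, (b k : ℂ) * polarTerm k s

/-- The regularity needed to continue the Mellin transform of `f`: continuity on `(0, ∞)`, rapid
decrease at infinity, and an expansion `f(x) ∼ ∑ b_k x^(k-1)` at `0⁺`. -/
structure IsMellinKernel (f : ℝ → ℝ) (b : ℕ → ℝ) : Prop where
  continuousOn : ContinuousOn f (Ioi 0)
  decay : ∀ k : ℕ, Tendsto (fun x => x ^ k * f x) atTop (𝓝 0)
  expansion : ∀ m : ℕ,
    (fun x => x * f x - ∑ k ∈ Finset.range m, b k * x ^ k) =O[𝓝[>] 0] fun x => x ^ m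

namespace IsMellinKernel

theorem mellinConvergent (h : IsMellinKernel f b) {m : ℕ} {s : ℂ} (hs : 1 - (m : ℝ) < s.re) :
    MellinConvergent (mellinRemainder f b m) s := by
  obtain ⟨k, hk⟩ := exists_nat_gt s.re
  exact mellinConvergent_of_isBigO_rpow (locallyIntegrableOn_mellinRemainder h.continuousOn m)
    (mellinRemainder_isBigO_atTop h.decay m k) hk (mellinRemainder_isBigO_zero h.expansion m) hs

theorem differentiableAt_partialContinuation (h : IsMellinKernel f b) {m : ℕ} {s : ℂ}
    (hs : 1 - (m : ℝ) < s.re) (hs1 : s ≠ 1) :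
    DifferentiableAt ℂ (partialContinuation f b m) s := by
  obtain ⟨k, hk⟩ := exists_nat_gt s.re
  have hd := mellin_differentiableAt_of_isBigO_rpow
    (locallyIntegrableOn_mellinRemainder h.continuousOn m)
    (mellinRemainder_isBigO_atTop h.decay m k) hk (mellinRemainder_isBigO_zero h.expansion m) hs
  refine (Complex.differentiable_one_div_Gamma.differentiableAt.mul hd).add ?_
  exact DifferentiableAt.fun_sum fun k _ => (differentiableAt_polarTerm k hs1).const_mul _

theorem partialContinuation_succ (h : IsMellinKernel f b) {m : ℕ} {s : ℂ}
    (hs : 1 - (m : ℝ) < s.re) :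
    partialContinuation f b (m + 1) s = partialContinuation f b m s := by
  have hre : 0 < s.re + ((m : ℂ) - 1).re := by simp; linarith
  have h1 := hasMellin_cpow_Ioc ((m : ℂ) - 1) hre
  have h2 := hasMellin_const_smul h1.1 (b m : ℂ)
  have h3 := (hasMellin_sub (h.mellinConvergent hs) h2.1).2
  have hne : s + ((m : ℂ) - 1) ≠ 0 := fun h0 => by
    have := congrArg Complex.re h0
    rw [Complex.add_re, Complex.zero_re] at this
    linarith
  have h4 : mellin (mellinRemainder f b (m + 1)) s =
      mellin (mellinRemainder f b m) s - (b m : ℂ) * (s + ((m : ℂ) - 1))⁻¹ := by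
    have h5 : mellinRemainder f b (m + 1) = fun x => mellinRemainder f b m x -
      (b m : ℂ) • indicator (Ioc 0 1) (fun t : ℝ => (t : ℂ) ^ ((m : ℂ) - 1)) x :=
      funext (mellinRemainder_succ m)
    rw [h5, h3, h2.2, h1.2, smul_eq_mul, one_div]
  rw [partialContinuation, partialContinuation, Finset.sum_range_succ, h4, polarTerm_eq m hne]
  ring

theorem partialContinuation_add (h : IsMellinKernel f b) {m : ℕ} {s : ℂ}
    (hs : 1 - (m : ℝ) < s.re) (j : ℕ) :
    partialContinuation f b (m + j) s = partialContinuation f b m s := by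
  induction j with
  | zero => rfl
  | succ j ih =>
    rw [← add_assoc, h.partialContinuation_succ, ih]
    push_cast
    have : (0 : ℝ) ≤ j := Nat.cast_nonneg j
    linarith

theorem partialContinuation_eq (h : IsMellinKernel f b) {m m' : ℕ} {s : ℂ}
    (hs : 1 - (m : ℝ) < s.re) (hs' : 1 - (m' : ℝ) < s.re) :
    partialContinuation f b m s = partialContinuation f b m' s := by
  rw [← h.partialContinuation_add hs m', ← h.partialContinuation_add hs' m, add_comm]

/-- The Mellin transform of `f`, divided by `Γ(s)`, continues to `ℂ \ {1}`, and its value at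
`1 - n` is read off from the expansion of `f` at `0⁺`. -/
theorem exists_continuation (h : IsMellinKernel f b) : ∃ Z : ℂ → ℂ,
    DifferentiableOn ℂ Z {1}ᶜ ∧
    (∀ s : ℂ, 1 < s.re → MellinConvergent (fun x => (f x : ℂ)) s ∧
      Z s = 1 / Complex.Gamma s * mellin (fun x => (f x : ℂ)) s) ∧
    ∀ n : ℕ, 1 ≤ n → Z (1 - (n : ℂ)) = (-1) ^ (n - 1) * ((n - 1)! : ℂ) * (b n : ℂ) := by
  have hex : ∀ s : ℂ, ∃ m : ℕ, 1 - (m : ℝ) < s.re := fun s => by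
    obtain ⟨m, hm⟩ := exists_nat_gt (1 - s.re)
    exact ⟨m, by linarith⟩
  choose M hM using hex
  have hR0 : mellinRemainder f b 0 = fun x => (f x : ℂ) := by
    funext x; simp [mellinRemainder]
  refine ⟨fun s => partialContinuation f b (M s) s, fun s hs => ?_, fun s hs => ?_, fun n hn => ?_⟩
  · have hs1 : s ≠ 1 := by simpa using hs
    -- near `s` the continuation is given by one and the same `m`
    have hnear : (fun z => partialContinuation f b (M z) z) =ᶠ[𝓝 s]
        partialContinuation f b (M s) := by
      filter_upwards [(isOpen_lt continuous_const Complex.continuous_re).mem_nhds (hM s)] with z hz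
      exact h.partialContinuation_eq (hM z) hz
    exact ((h.differentiableAt_partialContinuation (hM s) hs1).congr_of_eventuallyEq
      hnear).differentiableWithinAt
  · have hs0 : 1 - ((0 : ℕ) : ℝ) < s.re := by simpa using hs
    refine ⟨hR0 ▸ h.mellinConvergent hs0, ?_⟩
    change partialContinuation f b (M s) s = _
    rw [h.partialContinuation_eq (hM s) hs0, partialContinuation, hR0]
    simp
  · have hlt : 1 - ((n + 1 : ℕ) : ℝ) < (1 - (n : ℂ)).re := by simp
    -- Mathlib gives `Γ` the value `0` at its poles, so that `Γ⁻¹` is the entire function `1 / Γ`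
    have hG : Complex.Gamma (1 - (n : ℂ)) = 0 := by
      obtain ⟨r, rfl⟩ := Nat.exists_eq_add_of_le' hn
      have : (1 - ((r + 1 : ℕ) : ℂ)) = -(r : ℂ) := by push_cast; ring
      rw [this, Complex.Gamma_neg_nat_eq_zero]
    change partialContinuation f b (M (1 - (n : ℂ))) (1 - (n : ℂ)) = _
    rw [h.partialContinuation_eq (hM _) hlt, partialContinuation, hG, inv_zero, zero_mul, zero_add,
      Finset.sum_range_succ, Finset.sum_eq_zero, zero_add, polarTerm_one_sub_self hn, mul_comm]
    intro k hk
    rw [polarTerm_one_sub_of_lt hn (Finset.mem_range.mp hk), mul_zero]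

end IsMellinKernel

theorem isHurwitzContinuation_unique {G : ℝ → ℝ} {a : ℝ} {Z Z' : ℂ → ℂ}
    (hZ : IsHurwitzContinuation G a Z) (hZ' : IsHurwitzContinuation G a Z') :
    EqOn Z Z' {1}ᶜ := by
  have hopen : IsOpen ({1}ᶜ : Set ℂ) := isOpen_compl_singleton
  have hnear : Z =ᶠ[𝓝 2] Z' := by
    have h2 : {s : ℂ | 1 < s.re} ∈ 𝓝 (2 : ℂ) :=
      (isOpen_lt continuous_const Complex.continuous_re).mem_nhds (by norm_num)
    filter_upwards [h2] with s hs
    rw [(hZ.2 s hs).2, (hZ'.2 s hs).2]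
  exact (hZ.1.analyticOnNhd hopen).eqOn_of_preconnected_of_eventuallyEq
    (hZ'.1.analyticOnNhd hopen)
    (isConnected_compl_singleton_of_one_lt_rank (by simp) 1).isPreconnected
    (by norm_num : (2 : ℂ) ∈ ({1}ᶜ : Set ℂ)) hnear

theorem hurwitzZeta_eq {G : ℝ → ℝ} {a : ℝ} {Z : ℂ → ℂ} (hZ : IsHurwitzContinuation G a Z) {s : ℂ}
    (hs : s ≠ 1) : hurwitzZeta G s a = Z s := by
  have hex : ∃ Z : ℂ → ℂ, IsHurwitzContinuation G a Z := ⟨Z, hZ⟩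
  rw [hurwitzZeta, dif_pos hex]
  exact isHurwitzContinuation_unique hex.choose_spec hZ hs

end MellinContinuation

end FormalGroupZeta

/-! ### Special values -/

namespace FormalGroupZeta

open Filter Topology Asymptotics Set

open scoped Nat

section SpecialValues

theorem isMellinKernel_of_isHurwitzKernel {G : ℝ → ℝ} {g h V : PowerSeries ℚ}
    (hG : IsHurwitzKernel g G) (hg : g = PowerSeries.X * h) (hV : h * V = 1) {a : ℝ} (ha : 0 < a) :
    IsMellinKernel (fun x => Real.exp (-a * x) / G x) fun k => PowerSeries.coeff k
      (PowerSeries.map (algebraMap ℚ ℝ) V * PowerSeries.rescale (-a) (PowerSeries.exp ℝ)) where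
  continuousOn := (hG.smooth a ha).continuousOn
  decay := hG.rapidDecay a ha
  expansion := by
    have h1 : HasAsymptoticExpansion G
        (PowerSeries.X * PowerSeries.map (algebraMap ℚ ℝ) h) := by
      intro m
      refine (hG.expansion m).congr_left fun x => ?_
      have : PowerSeries.X * PowerSeries.map (algebraMap ℚ ℝ) h =
          PowerSeries.map (algebraMap ℚ ℝ) g := by rw [hg, map_mul, PowerSeries.map_X]
      rw [this, eval_trunc_eq_sum]
      simp [PowerSeries.coeff_map]
    have h2 : PowerSeries.map (algebraMap ℚ ℝ) h * PowerSeries.map (algebraMap ℚ ℝ) V = 1 := by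
      rw [← map_mul, hV, map_one]
    intro m
    refine (((h1.div_id.inv h2).mul (hasAsymptoticExpansion_exp (-a))) m).congr_left fun x => ?_
    dsimp only
    rw [eval_trunc_eq_sum, inv_div]
    ring

theorem pow_mul_factorial_mul_coeff_mul_exp (V : PowerSeries ℚ) {N : ℕ} (hN : N ≠ 0) (j n : ℕ) :
    (N : ℝ) ^ n * n ! * PowerSeries.coeff n (PowerSeries.map (algebraMap ℚ ℝ) V *
      PowerSeries.rescale (-((j : ℝ) / N)) (PowerSeries.exp ℝ)) =
    ((∑ k ∈ Finset.range (n + 1), (n.choose k : ℚ) * ((N : ℤ) : ℚ) ^ k *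
      ((k ! : ℚ) * PowerSeries.coeff k V) * ((-j : ℤ) : ℚ) ^ (n - k) : ℚ) : ℝ) := by
  have hN' : (N : ℝ) ≠ 0 := Nat.cast_ne_zero.mpr hN
  rw [PowerSeries.coeff_mul, Finset.Nat.sum_antidiagonal_eq_sum_range_succ_mk, Finset.mul_sum]
  push_cast
  refine Finset.sum_congr rfl fun k hk => ?_
  have hkn : k ≤ n := by rw [Finset.mem_range] at hk; omega
  obtain ⟨r, rfl⟩ := Nat.exists_eq_add_of_le hkn
  rw [PowerSeries.coeff_map, PowerSeries.coeff_rescale, PowerSeries.coeff_exp,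
    Nat.add_sub_cancel_left]
  have hch : (((k + r)! : ℕ) : ℝ) = ((k + r).choose k : ℝ) * k ! * r ! := by
    have := Nat.choose_mul_factorial_mul_factorial (Nat.le_add_right k r)
    rw [Nat.add_sub_cancel_left] at this
    exact_mod_cast this.symm
  have hr : ((r ! : ℕ) : ℝ) ≠ 0 := by exact_mod_cast r.factorial_ne_zero
  rw [hch, pow_add, ← neg_div, div_pow]
  simp only [eq_ratCast]
  push_cast
  field_simp

theorem sum_Icc_natCast_zmod {M : Type*} [AddCommMonoid M] {N : ℕ} [NeZero N] (f : ZMod N → M) :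
    ∑ j ∈ Finset.Icc 1 N, f (j : ZMod N) = ∑ a, f a := by
  have h1 : ∀ g : ZMod N → M, ∑ j ∈ Finset.range N, g (j : ZMod N) = ∑ a, g a := fun g =>
    Finset.sum_nbij' (fun j => (j : ZMod N)) ZMod.val (fun _ _ => Finset.mem_univ _)
      (fun a _ => Finset.mem_range.mpr a.val_lt)
      (fun j hj => ZMod.val_cast_of_lt (Finset.mem_range.mp hj))
      (fun a _ => ZMod.natCast_zmod_val a) fun _ _ => rfl
  rw [← Equiv.sum_comp (Equiv.addRight (1 : ZMod N)) f, ← h1,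
    Finset.range_eq_Ico, ← Finset.Ico_add_one_right_eq_Icc]
  rw [← Finset.sum_Ico_add' (fun j : ℕ => f (j : ZMod N)) 0 N 1]
  simp

theorem exists_isHurwitzContinuation {G : ℝ → ℝ} {g h V : PowerSeries ℚ}
    (hG : IsHurwitzKernel g G) (hg : g = PowerSeries.X * h) (hV : h * V = 1) {a : ℝ} (ha : 0 < a) :
    ∃ Z : ℂ → ℂ, IsHurwitzContinuation G a Z ∧ ∀ n : ℕ, 1 ≤ n → Z (1 - (n : ℂ)) =
      (-1) ^ (n - 1) * ((n - 1)! : ℂ) * ((PowerSeries.coeff n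
        (PowerSeries.map (algebraMap ℚ ℝ) V *
          PowerSeries.rescale (-a) (PowerSeries.exp ℝ)) : ℝ) : ℂ) := by
  obtain ⟨Z, h1, h2, h3⟩ := (isMellinKernel_of_isHurwitzKernel hG hg hV ha).exists_continuation
  exact ⟨Z, ⟨h1, h2⟩, h3⟩

/-- For odd `n` the number `n N^n ζ^G(1 - n, j / N)` is `n! [t^n] e^{-jt} V(Nt)` with
`V = t / F⁻¹(t)`. Up to an integer it equals `n! [t^n] V(Nt)`, which does not depend on `j`. -/
theorem exists_int_hurwitzZeta_eq (c : ℕ → ℤ) (h0 : c 0 = 1) {G : ℝ → ℝ}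
    (hG : IsHurwitzKernel (formalExp c h0) G)
    (hc : ∀ p : ℕ, p.Prime → c (p - 1) ≡ 1 [ZMOD (p : ℤ)]) {N : ℕ} (hN : N ≠ 0) {n : ℕ}
    (hn : Odd n) (h3 : 3 ≤ n) : ∃ K : ℂ, ∀ j : ℕ, 1 ≤ j → ∃ w : ℤ,
      (n : ℂ) * (N : ℂ) ^ n * hurwitzZeta G (1 - (n : ℂ)) ((j : ℝ) / (N : ℝ)) = w + K := by
  obtain ⟨h, V, hg, hV, hb⟩ := exists_formalExp_factorization h0
  refine ⟨((((N : ℤ) : ℚ) ^ n * ((n ! : ℚ) * PowerSeries.coeff n V) : ℚ) : ℂ), fun j hj => ?_⟩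
  obtain ⟨w, hw⟩ := exists_int_eq_sum_choose h0 hc hb N (-j) hn h3
  refine ⟨w, ?_⟩
  have ha : 0 < (j : ℝ) / N := by
    have : 0 < N := Nat.pos_of_ne_zero hN
    positivity
  obtain ⟨Z, hZ, hZn⟩ := exists_isHurwitzContinuation hG hg hV ha
  have hs : (1 - (n : ℂ)) ≠ 1 := by
    have : (n : ℂ) ≠ 0 := by
      rw [Nat.cast_ne_zero]; omega
    simpa using this
  rw [hurwitzZeta_eq hZ hs, hZn n (by omega)]
  have hval := pow_mul_factorial_mul_coeff_mul_exp V hN j n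
  rw [Finset.sum_range_succ, hw, Nat.choose_self, Nat.sub_self, pow_zero, mul_one, Nat.cast_one,
    one_mul] at hval
  have hval' := congrArg (fun x : ℝ => (x : ℂ)) hval
  obtain ⟨r, rfl⟩ := hn
  simp only [Nat.add_sub_cancel, (even_two_mul r).neg_one_pow, one_mul]
  rw [Nat.factorial_succ] at hval' ⊢
  push_cast at hval' ⊢
  rw [← hval']
  ring

end SpecialValues

end FormalGroupZeta

theorem mainTheorem5
    (c : ℕ → ℤ) (h0 : c 0 = 1)
    (G : ℝ → ℝ) (hG : FormalGroupZeta.IsHurwitzKernel (FormalGroupZeta.formalExp c h0) G)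
    (hc : ∀ p : ℕ, p.Prime → c (p - 1) ≡ 1 [ZMOD (p : ℤ)])
    (hc13 : c 1 ≡ c 3 [ZMOD 2] ∨ (Odd (c 1) ∧ Even (c 3)))
    (N : ℕ) (hN : N ≠ 0) (χ : DirichletCharacter ℂ N)
    (hχ : χ.conductor = N) (hχ1 : χ ≠ 1) :
    (∀ a : ℝ, 0 < a → ∃ Z : ℂ → ℂ, FormalGroupZeta.IsHurwitzContinuation G a Z) ∧
    ∀ n : ℕ, Odd n → 3 ≤ n →
      (n : ℂ) * (N : ℂ) * FormalGroupZeta.LFunction G χ (1 - (n : ℂ)) ∈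
        Algebra.adjoin ℤ (Set.range (χ : ZMod N → ℂ)) := by
  refine ⟨fun a ha => ?_, fun n hn h3 => ?_⟩
  · obtain ⟨h, V, hg, hV, -⟩ := FormalGroupZeta.exists_formalExp_factorization h0
    obtain ⟨Z, hZ, -⟩ := FormalGroupZeta.exists_isHurwitzContinuation hG hg hV ha
    exact ⟨Z, hZ⟩
  · have : NeZero N := ⟨hN⟩
    obtain ⟨K, hK⟩ := FormalGroupZeta.exists_int_hurwitzZeta_eq c h0 hG hc hN hn h3
    choose! w hw using hK
    have hN' : (N : ℂ) ≠ 0 := Nat.cast_ne_zero.mpr hN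
    have hpow : (N : ℂ) * (1 / (N : ℂ) ^ (1 - (n : ℂ))) = (N : ℂ) ^ n := by
      rw [Complex.cpow_sub _ _ hN', Complex.cpow_one, Complex.cpow_natCast]
      field_simp
    have hχ0 : ∑ j ∈ Finset.Icc 1 N, χ (j : ZMod N) = 0 := by
      rw [FormalGroupZeta.sum_Icc_natCast_zmod (fun a => χ a)]
      exact MulChar.sum_eq_zero_of_ne_one hχ1
    have hsum : (n : ℂ) * (N : ℂ) * FormalGroupZeta.LFunction G χ (1 - (n : ℂ)) =
        ∑ j ∈ Finset.Icc 1 N, χ (j : ZMod N) * (w j : ℂ) := by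
      calc (n : ℂ) * (N : ℂ) * FormalGroupZeta.LFunction G χ (1 - (n : ℂ))
          = ∑ j ∈ Finset.Icc 1 N, χ (j : ZMod N) * ((n : ℂ) * (N : ℂ) ^ n *
              FormalGroupZeta.hurwitzZeta G (1 - (n : ℂ)) ((j : ℝ) / (N : ℝ))) := by
            rw [FormalGroupZeta.LFunction, ← hpow, Finset.mul_sum, Finset.mul_sum]
            refine Finset.sum_congr rfl fun j _ => ?_
            ring
        _ = ∑ j ∈ Finset.Icc 1 N, (χ (j : ZMod N) * (w j : ℂ) + χ (j : ZMod N) * K) := by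
            refine Finset.sum_congr rfl fun j hj => ?_
            rw [hw j (Finset.mem_Icc.mp hj).1, mul_add]
        _ = ∑ j ∈ Finset.Icc 1 N, χ (j : ZMod N) * (w j : ℂ) := by
            rw [Finset.sum_add_distrib, ← Finset.sum_mul, hχ0, zero_mul, add_zero]
    rw [hsum]
    refine sum_mem fun j _ => mul_mem (Algebra.subset_adjoin ⟨_, rfl⟩) ?_
    exact intCast_mem _ (w j)
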